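/- Let $S$ be a finite-dimensional classical or quantum state space on at least three letters: either the simplex of probability vectors $p=(p_i)_{i\in I}$ on a finite set $I$ with $|I|\ge 3$, or the set of density matrices (positive semidefinite, trace one) on $\mathbb{C}^n$ with $n\ge 3$. An action is an affine map $a$ from $S$ to the probability measures on $\mathbb{R}$ with finite means; write $E[a(s)]$ for the mean of $a(s)$. Let $\mathcal{A}$ be a set of actions such that $F(s)=\sup_{a\in\mathcal{A}}E[a(s)]$ is finite for every $s\in S$, and define the regret by $$D_F(s_1,s_2)=F(s_1)-\sup_{(a_k)}\limsup_{k\to\infty}E[a_k(s_1)],$$ where the supremum is over all sequences $(a_k)$ in $\mathcal{A}$ with $E[a_k(s_2)]\to F(s_2)$. A transformation of $S$ is a map $S\to S$ induced by a completely positive trace-preserving linear map (in the classical case, by a column-stochastic matrix). A transformation $\Phi$ is sufficient for $(s_1,s_2)$ if there is a transformation $\Psi$ with $\Psi(\Phi(s_j))=s_j$ for $j=1,2$. Suppose that $D_F$ has the sufficiency property: $D_F(\Phi(s_1),\Phi(s_2))=D_F(s_1,s_2)$ for all $s_1,s_2\in S$ and every transformation $\Phi$ that is sufficient for $(s_1,s_2)$.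 Then there are a constant $c\ge 0$ and an affine function $\ell$ such that $$F(s)=-c\,H(s)+\ell(s)\quad\text{for all } s\in S,\qquad D_F(s_1,s_2)=c\,D(s_1\|s_2)\quad\text{for all } s_1,s_2\in S,$$ with the convention $0\cdot\infty=0$. Here, classically, $H(p)=-\sum_i p_i\log p_i$ and $D(p\|q)=\sum_i p_i\log(p_i/q_i)$ (equal to $+\infty$ unless $q_i=0$ implies $p_i=0$); in the quantum case, $H(\rho)=-\operatorname{Tr}(\rho\log\rho)$ and $D(\rho\|\sigma)=\operatorname{Tr}\big(\rho(\log\rho-\log\sigma)\big)$ (equal to $+\infty$ unless $\ker\sigma\subseteq\ker\rho$). -/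

import Mathlib

open MeasureTheory Filter Topology

namespace Regret

noncomputable section

section General

/-- An action on a convex set of states `S`: an affine map `law` sending every state to a
probability distribution on the real numbers (the law of the payoff), each with finite mean. -/
structure Action {E : Type*} [AddCommGroup E] [Module ℝ E] (S : Set E) where
  law : S → ProbabilityMeasure ℝ
  affine : ∀ (x y z : S) (t : ℝ), 0 ≤ t → t ≤ 1 → (z : E) = (1 - t) • (x : E) + t • (y : E) →
    (law z : Measure ℝ) =
      ENNReal.ofReal (1 - t) • (law x : Measure ℝ) + ENNReal.ofReal t • (law y : Measure ℝ)
  integrable : ∀ s : S, Integrable (fun r : ℝ => r) (law s : Measure ℝ)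

/-- The expected payoff `E[a(s)]` of the action `a` in the state `s`. -/
def Action.mean {E : Type*} [AddCommGroup E] [Module ℝ E] {S : Set E} (a : Action S) (s : S) : ℝ :=
  ∫ r, r ∂(a.law s : Measure ℝ)

/-- The optimal payoff `F(s) = sup_{a ∈ A} E[a(s)]`, with values in the extended reals. -/
def payoff {E : Type*} [AddCommGroup E] [Module ℝ E] {S : Set E} (A : Set (Action S)) (s : S) :
    EReal :=
  ⨆ a ∈ A, ((a.mean s : ℝ) : EReal)

/-- A sequence of actions of `A` is asymptotically optimal for `s` if `E[a_n(s)] → F(s)`. -/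
def IsAsymptoticallyOptimal {E : Type*} [AddCommGroup E] [Module ℝ E] {S : Set E}
    (A : Set (Action S)) (a : ℕ → Action S) (s : S) : Prop :=
  (∀ n, a n ∈ A) ∧ Tendsto (fun n => (((a n).mean s : ℝ) : EReal)) atTop (𝓝 (payoff A s))

/-- The regret `D_F(s₁, s₂) = F(s₁) - sup limsup E[a_n(s₁)]`, the supremum being over all sequences
of actions that are asymptotically optimal for `s₂`. It is meaningful when `F(s₁)` is finite. -/
def regret {E : Type*} [AddCommGroup E] [Module ℝ E] {S : Set E} (A : Set (Action S))
    (s₁ s₂ : S) : EReal :=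
  payoff A s₁ - ⨆ (a : ℕ → Action S) (_ : IsAsymptoticallyOptimal A a s₂),
    limsup (fun n => (((a n).mean s₁ : ℝ) : EReal)) atTop

/-- Relative to a class `K` of transformations of a state space into itself, `Φ` is sufficient for
the family `s` if some `Ψ` in the class satisfies `Ψ(Φ(s_θ)) = s_θ` for all `θ`. -/
def IsSufficient {S Θ : Type*} (K : Set (S → S)) (Φ : S → S) (s : Θ → S) : Prop :=
  ∃ Ψ ∈ K, ∀ θ, Ψ (Φ (s θ)) = s θ

/-- The sufficiency property of a divergence `D` relative to a class `K` of transformations: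
`D` is invariant under every `Φ` in the class that is sufficient for the pair of states. -/
def SufficiencyProperty {S : Type*} (K : Set (S → S)) (D : S → S → EReal) : Prop :=
  ∀ Φ ∈ K, ∀ s₁ s₂ : S, IsSufficient K Φ ![s₁, s₂] → D (Φ s₁) (Φ s₂) = D s₁ s₂

end General

section Classical

/-- The classical transformations: the maps of the simplex of probability vectors into itself that
are given by column-stochastic matrices. These are the completely positive transformations of a
classical state space, because on a commutative algebra positivity is complete positivity. -/
def classicalTransformations (ι : Type*) [Fintype ι] [DecidableEq ι] :
    Set (stdSimplex ℝ ι → stdSimplex ℝ ι) :=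
  {Φ | ∃ T ∈ Matrix.colStochastic ℝ ι, ∀ p, (Φ p : ι → ℝ) = T.mulVec (p : ι → ℝ)}

/-- Shannon entropy `-∑ pᵢ log pᵢ`. -/
def shannonEntropy {ι : Type*} [Fintype ι] (p : stdSimplex ℝ ι) : ℝ :=
  ∑ i, Real.negMulLog ((p : ι → ℝ) i)

open Classical in
/-- Information divergence `∑ pᵢ log (pᵢ / qᵢ)`, infinite if `p` is not absolutely continuous
with respect to `q`. -/
def infoDivergence {ι : Type*} [Fintype ι] (p q : stdSimplex ℝ ι) : EReal :=
  if ∀ i, (q : ι → ℝ) i = 0 → (p : ι → ℝ) i = 0 then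
    ((∑ i, (p : ι → ℝ) i * Real.log ((p : ι → ℝ) i / (q : ι → ℝ) i) : ℝ) : EReal)
  else ⊤

end Classical

section Quantum

open scoped ComplexOrder in
/-- The density matrices: positive semidefinite complex matrices of trace one. -/
def densityMatrices (n : Type*) [Fintype n] : Set (Matrix n n ℂ) :=
  {ρ | ρ.PosSemidef ∧ ρ.trace = 1}

open scoped MatrixOrder Matrix.Norms.L2Operator in
/-- The quantum transformations: the maps of the set of density matrices into itself that are
given by completely positive trace-preserving linear maps. -/
def quantumTransformations (n : Type*) [Fintype n] [DecidableEq n] :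
    Set (densityMatrices n → densityMatrices n) :=
  {Φ | ∃ T : CompletelyPositiveMap (Matrix n n ℂ) (Matrix n n ℂ),
    (∀ X, (T X).trace = X.trace) ∧ ∀ ρ, (Φ ρ : Matrix n n ℂ) = T (ρ : Matrix n n ℂ)}

/-- Von Neumann entropy `-Tr (ρ log ρ)`. -/
def vonNeumannEntropy {n : Type*} [Fintype n] [DecidableEq n] (ρ : densityMatrices n) : ℝ :=
  -((ρ : Matrix n n ℂ) * cfc Real.log (ρ : Matrix n n ℂ)).trace.re

open Classical in
/-- Quantum relative entropy `Tr (ρ (log ρ - log σ))`, infinite if the kernel of `σ` is not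
contained in the kernel of `ρ`. -/
def quantumRelativeEntropy {n : Type*} [Fintype n] [DecidableEq n] (ρ σ : densityMatrices n) :
    EReal :=
  if ∀ v : n → ℂ, (σ : Matrix n n ℂ).mulVec v = 0 → (ρ : Matrix n n ℂ).mulVec v = 0 then
    ((((ρ : Matrix n n ℂ) *
      (cfc Real.log (ρ : Matrix n n ℂ) - cfc Real.log (σ : Matrix n n ℂ))).trace.re : ℝ) : EReal)
  else ⊤

end Quantum

end

end Regret

/-! ### Regret as the Bregman divergence of the optimal payoff. -/

namespace Regret

section General

variable {E : Type*} [AddCommGroup E] [Module ℝ E] {S : Set E}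

/-! The payoff F is a supremum of affine functions, hence convex, and the regret is its Bregman
divergence: F(s₁) - F(s₂) minus the right derivative of F at s₂ towards s₁ (`IsPayoff.regret_eq`).
Let Ψ undo Φ at two states. By affinity it undoes Φ on the whole segment between them, so
sufficiency makes the Bregman divergences of F and F∘Φ agree there. Convex functions on a segment
with equal Bregman divergences differ by an affine function, so F∘Φ - F is affine on every
recoverable segment (`IsCovariant`). The rest uses only convexity and this covariance.

Classically, subtract an affine function to get g vanishing at the vertices. Relabelling letters
shows that g is the same function h on all edges. Merging two letters is reversible once their
conditional distribution is known, which gives the grouping rule. Grouping a three-point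
distribution in two ways is the fundamental equation of information for h. Its solution yields an
additive function φ(n)/n on the integers. Convexity makes that function monotone, hence a multiple
of log, and then extends the formula from rational points by continuity. Induction on the size of
the support carries the result from edges to the simplex.

In the quantum case stochastic matrices lift to channels on diagonal states, so F + cH is affine
there for some c ≥ 0. Unitaries are reversible, so F + cH changes by an affine function under each
of them. Averaging over diagonal sign matrices and subtracting a linear function leaves k, invariant
under signs and zero on diagonal states. Reflections in coordinate planes shrink the support of a
state vector while preserving k = 0, so k vanishes on pure states; the spectral theorem then gives k
= 0 everywhere (`IsUnitarilyAffine.exists_linearMap`).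

Finally the relative entropy is the Bregman divergence of -H. Klein's inequality traps the slope of
-H. If ker σ ⊆ ker ρ, positive eigenvalues stay away from 0 and the bounds meet; otherwise one
eigenvalue of weight bounded below is O(u), and the slope tends to -∞ like log u. -/

theorem Action.mean_affine (a : Action S) (x y z : S) (t : ℝ) (h0 : 0 ≤ t) (h1 : t ≤ 1)
    (hz : (z : E) = (1 - t) • (x : E) + t • (y : E)) :
    a.mean z = (1 - t) * a.mean x + t * a.mean y := by
  unfold Action.mean
  rw [a.affine x y z t h0 h1 hz, integral_add_measure, integral_smul_measure,
    integral_smul_measure, ENNReal.toReal_ofReal (by linarith), ENNReal.toReal_ofReal h0,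
    smul_eq_mul, smul_eq_mul]
  · exact (a.integrable x).smul_measure ENNReal.ofReal_ne_top
  · exact (a.integrable y).smul_measure ENNReal.ofReal_ne_top

/-- `f` is a real-valued version of the optimal payoff of `A`. -/
def IsPayoff (A : Set (Action S)) (f : E → ℝ) : Prop :=
  ∀ s : S, payoff A s = (f s : EReal)

theorem exists_isPayoff {A : Set (Action S)} (h : ∀ s, ∃ r : ℝ, payoff A s = (r : EReal)) :
    ∃ f : E → ℝ, IsPayoff A f := by
  classical
  choose r hr using h
  exact ⟨fun x => if hx : x ∈ S then r ⟨x, hx⟩ else 0, fun s => by simp [hr]⟩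

theorem IsPayoff.mean_le {A : Set (Action S)} {f : E → ℝ} (hf : IsPayoff A f) {a : Action S}
    (ha : a ∈ A) (s : S) : a.mean s ≤ f s := by
  have : ((a.mean s : ℝ) : EReal) ≤ f s := by
    rw [← hf s]
    exact le_iSup₂_of_le a ha le_rfl
  exact_mod_cast this

theorem IsPayoff.exists_lt {A : Set (Action S)} {f : E → ℝ} (hf : IsPayoff A f) (s : S) {r : ℝ}
    (hr : r < f s) : ∃ a ∈ A, r < a.mean s := by
  have : (r : EReal) < payoff A s := by rw [hf s]; exact_mod_cast hr
  obtain ⟨a, ha⟩ := lt_iSup_iff.1 this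
  obtain ⟨ha, h⟩ := lt_iSup_iff.1 ha
  exact ⟨a, ha, by exact_mod_cast h⟩

theorem IsPayoff.convexOn {A : Set (Action S)} {f : E → ℝ} (hf : IsPayoff A f)
    (hS : Convex ℝ S) : ConvexOn ℝ S f := by
  refine ⟨hS, fun x hx y hy a b ha hb hab => ?_⟩
  refine le_of_forall_lt fun r hr => ?_
  obtain ⟨c, hc, h⟩ := hf.exists_lt ⟨_, hS hx hy ha hb hab⟩ hr
  rw [c.mean_affine ⟨x, hx⟩ ⟨y, hy⟩ _ b hb (by linarith) (by simp [← hab])] at h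
  have h1 := hf.mean_le hc ⟨x, hx⟩
  have h2 := hf.mean_le hc ⟨y, hy⟩
  rw [smul_eq_mul, smul_eq_mul, ← show 1 - b = a by linarith]
  have := mul_le_mul_of_nonneg_left h1 (show 0 ≤ 1 - b by linarith)
  have := mul_le_mul_of_nonneg_left h2 hb
  simp only at *
  linarith

/-- The slope of `f` along the segment from `y` to `x`. -/
noncomputable def segmentSlope (f : E → ℝ) (x y : E) (u : ℝ) : ℝ := u⁻¹ * (f (y + u • (x - y)) - f y)

/-- An action's mean at s₁ is the extrapolation of its means at s₂ and at the point with parameter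
`u`. The latter is at most `f`, and the former tends to `f s₂` along an asymptotically optimal
sequence. -/
theorem IsPayoff.iSup_limsup_le {A : Set (Action S)} {f : E → ℝ} (hf : IsPayoff A f)
    (hS : Convex ℝ S) (s₁ s₂ : S) (u : ℝ) (h0 : 0 < u) (h1 : u ≤ 1) :
    (⨆ (a : ℕ → Action S) (_ : IsAsymptoticallyOptimal A a s₂),
      limsup (fun n => (((a n).mean s₁ : ℝ) : EReal)) atTop) ≤
      ((f s₂ + segmentSlope f s₁ s₂ u : ℝ) : EReal) := by
  refine iSup₂_le fun a ha => ?_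
  have hmem : (s₂ : E) + u • ((s₁ : E) - s₂) ∈ S := by
    have := hS s₂.2 s₁.2 (show 0 ≤ 1 - u by linarith) h0.le (by ring)
    convert this using 1
    module
  have hlim : Tendsto (fun n => (a n).mean s₂) atTop (𝓝 (f s₂)) := by
    have := ha.2
    rw [hf s₂] at this
    exact EReal.tendsto_coe.1 this
  have hb : Tendsto (fun n => u⁻¹ * (f ((s₂ : E) + u • ((s₁ : E) - s₂)) - (1 - u) * (a n).mean s₂))
      atTop (𝓝 (f s₂ + segmentSlope f s₁ s₂ u)) := by
    have : f s₂ + segmentSlope f s₁ s₂ u =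
        u⁻¹ * (f ((s₂ : E) + u • ((s₁ : E) - s₂)) - (1 - u) * f s₂) := by
      unfold segmentSlope; field_simp; ring
    rw [this]
    exact (tendsto_const_nhds.sub (hlim.const_mul _)).const_mul _
  rw [← (EReal.tendsto_coe.2 hb).limsup_eq]
  refine limsup_le_limsup (Eventually.of_forall fun n => ?_)
  have h := hf.mean_le (ha.1 n) ⟨_, hmem⟩
  rw [(a n).mean_affine s₂ s₁ _ u h0.le h1 (by simp only; module)] at h
  simp only at h ⊢
  rw [EReal.coe_le_coe_iff, ← sub_nonneg]
  have : u⁻¹ * (f ((s₂ : E) + u • ((s₁ : E) - s₂)) - (1 - u) * (a n).mean s₂) - (a n).mean s₁ =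
    u⁻¹ * (f ((s₂ : E) + u • ((s₁ : E) - s₂)) -
      ((1 - u) * (a n).mean s₂ + u * (a n).mean s₁)) := by field_simp; ring
  rw [this]
  exact mul_nonneg (by positivity) (by linarith)

/-- The right derivative of a convex function along a segment is attained by an asymptotically
optimal sequence. -/
theorem IsPayoff.exists_isAsymptoticallyOptimal {A : Set (Action S)} {f : E → ℝ}
    (hf : IsPayoff A f) (hS : Convex ℝ S) (s₁ s₂ : S) :
    ∃ a : ℕ → Action S, IsAsymptoticallyOptimal A a s₂ ∧ ∀ n : ℕ,
      f s₂ + segmentSlope f s₁ s₂ (1 / (n + 2)) - 1 / (n + 2) ≤ (a n).mean s₁ := by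
  set u : ℕ → ℝ := fun n => 1 / ((n : ℝ) + 2) with hu
  have u0 : ∀ n, 0 < u n := fun n => by simp only [hu]; positivity
  have u1 : ∀ n, u n < 1 := fun n => by
    simp only [hu]; rw [div_lt_one (by positivity)]; linarith [n.cast_nonneg (α := ℝ)]
  have hmem : ∀ n, (s₂ : E) + u n • ((s₁ : E) - s₂) ∈ S := fun n => by
    have := hS s₂.2 s₁.2 (show 0 ≤ 1 - u n by linarith [u1 n]) (u0 n).le (by ring)
    convert this using 1
    module
  -- Actions are chosen nearly optimal at points approaching s₂. The error is `u n ^ 2` because it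
  -- will be divided by `u n`.
  have hex : ∀ n, ∃ a ∈ A, f ((s₂ : E) + u n • ((s₁ : E) - s₂)) - u n ^ 2 <
      a.mean ⟨_, hmem n⟩ := fun n =>
    hf.exists_lt ⟨_, hmem n⟩ (by have := u0 n; simp only; nlinarith)
  choose a haA ha using hex
  have hmean : ∀ n, (a n).mean ⟨_, hmem n⟩ = (1 - u n) * (a n).mean s₂ + u n * (a n).mean s₁ :=
    fun n => (a n).mean_affine s₂ s₁ _ (u n) (u0 n).le (u1 n).le (by simp only; module)
  have hulim : Tendsto u atTop (𝓝 0) := by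
    have := (tendsto_one_div_add_atTop_nhds_zero_nat (𝕜 := ℝ)).comp (tendsto_add_atTop_nat 1)
    refine this.congr fun n => ?_
    simp [hu]; ring
  refine ⟨a, ⟨haA, ?_⟩, fun n => ?_⟩
  · rw [hf s₂, EReal.tendsto_coe]
    refine tendsto_order.2 ⟨fun r hr => ?_, fun r hr =>
      Eventually.of_forall fun n => (hf.mean_le (haA n) s₂).trans_lt hr⟩
    obtain ⟨b, hb, hbr⟩ := hf.exists_lt s₂ (show (r + f s₂) / 2 < f s₂ by linarith)
    -- `b` bounds `f` from below along the segment
    have hev : Tendsto (fun n => (1 - u n) * b.mean s₂ + u n * b.mean s₁ - u n ^ 2 - u n * f s₁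
        - (1 - u n) * r) atTop (𝓝 ((1 - 0) * b.mean s₂ + 0 * b.mean s₁ - 0 ^ 2 - 0 * f s₁
        - (1 - 0) * r)) :=
      (((((tendsto_const_nhds.sub hulim).mul_const _).add (hulim.mul_const _)).sub
        (hulim.pow 2)).sub (hulim.mul_const _)).sub ((tendsto_const_nhds.sub hulim).mul_const _)
    filter_upwards [hev.eventually_const_lt (u := 0) (by linarith)] with n hn
    have h1 := hf.mean_le hb ⟨_, hmem n⟩
    rw [b.mean_affine s₂ s₁ _ (u n) (u0 n).le (u1 n).le (by simp only; module)] at h1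
    have h2 := ha n
    rw [hmean n] at h2
    have h3 := mul_le_mul_of_nonneg_left (hf.mean_le (haA n) s₁) (u0 n).le
    simp only at h1
    have : (1 - u n) * r < (1 - u n) * (a n).mean s₂ := by linarith
    exact lt_of_mul_lt_mul_left this (by linarith [u1 n])
  · have h2 := ha n
    rw [hmean n] at h2
    have h3 := mul_le_mul_of_nonneg_left (hf.mean_le (haA n) s₂)
      (show 0 ≤ 1 - u n by linarith [u1 n])
    change f s₂ + segmentSlope f s₁ s₂ (u n) - u n ≤ _
    have h4 : u n * (f s₂ + segmentSlope f s₁ s₂ (u n) - u n) =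
        u n * f s₂ + (f ((s₂ : E) + u n • ((s₁ : E) - s₂)) - f s₂) - u n ^ 2 := by
      have := (u0 n).ne'
      unfold segmentSlope; field_simp
    refine le_of_mul_le_mul_left ?_ (u0 n)
    rw [h4]
    linarith

/-- The best limsup at s₁ is `f s₂` plus the directional derivative: each slope bounds it above, and
the sequence built from nearby points attains it. The limit may be ⊥, in which case the regret is
infinite. -/
theorem IsPayoff.regret_eq {A : Set (Action S)} {f : E → ℝ} (hf : IsPayoff A f)
    (hS : Convex ℝ S) (s₁ s₂ : S) {m : EReal}
    (hm : Tendsto (fun u => ((segmentSlope f s₁ s₂ u : ℝ) : EReal)) (𝓝[>] 0) (𝓝 m)) :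
    regret A s₁ s₂ = ((f s₁ - f s₂ : ℝ) : EReal) - m := by
  have hsum : (⨆ (a : ℕ → Action S) (_ : IsAsymptoticallyOptimal A a s₂),
      limsup (fun n => (((a n).mean s₁ : ℝ) : EReal)) atTop) = f s₂ + m := by
    apply le_antisymm
    · have h1 : Tendsto (fun u => ((f s₂ : ℝ) : EReal) + ((segmentSlope f s₁ s₂ u : ℝ) : EReal))
          (𝓝[>] 0) (𝓝 (f s₂ + m)) :=
        (EReal.continuousAt_add (p := ((f s₂ : EReal), m)) (Or.inl (by simp))
          (Or.inl (by simp))).tendsto.comp (tendsto_const_nhds.prodMk_nhds hm)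
      refine ge_of_tendsto h1 ?_
      filter_upwards [Ioc_mem_nhdsGT (zero_lt_one' ℝ)] with u hu
      have := hf.iSup_limsup_le hS s₁ s₂ u hu.1 hu.2
      rwa [EReal.coe_add] at this
    · obtain ⟨a, ha, h⟩ := hf.exists_isAsymptoticallyOptimal hS s₁ s₂
      refine le_trans ?_ (le_iSup₂ (f := fun (a : ℕ → Action S)
        (_ : IsAsymptoticallyOptimal A a s₂) =>
        limsup (fun n => (((a n).mean s₁ : ℝ) : EReal)) atTop) a ha)
      have hu : Tendsto (fun n : ℕ => 1 / ((n : ℝ) + 2)) atTop (𝓝[>] 0) := by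
        refine tendsto_nhdsWithin_iff.2 ⟨?_, Eventually.of_forall fun n => ?_⟩
        · have := (tendsto_one_div_add_atTop_nhds_zero_nat (𝕜 := ℝ)).comp
            (tendsto_add_atTop_nat 1)
          refine this.congr fun n => ?_
          simp; ring
        · simp only [Set.mem_Ioi]; positivity
      have h2 : Tendsto (fun n : ℕ => ((f s₂ - 1 / ((n : ℝ) + 2) : ℝ) : EReal)) atTop
          (𝓝 ((f s₂ : ℝ) : EReal)) := by
        rw [EReal.tendsto_coe]
        simpa using tendsto_const_nhds.sub (hu.mono_right nhdsWithin_le_nhds)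
      have h1 : Tendsto (fun n : ℕ => ((f s₂ - 1 / ((n : ℝ) + 2) : ℝ) : EReal) +
          ((segmentSlope f s₁ s₂ (1 / ((n : ℝ) + 2)) : ℝ) : EReal)) atTop (𝓝 (f s₂ + m)) :=
        (EReal.continuousAt_add (p := ((f s₂ : EReal), m)) (Or.inl (by simp))
          (Or.inl (by simp))).tendsto.comp (h2.prodMk_nhds (hm.comp hu))
      rw [← h1.limsup_eq]
      refine limsup_le_limsup (Eventually.of_forall fun n => ?_)
      simp only
      rw [← EReal.coe_add, EReal.coe_le_coe_iff]
      have := h n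
      linarith
  unfold regret
  rw [hsum, hf s₁]
  induction m using EReal.rec with
  | bot => norm_cast
  | top => simp
  | coe m => norm_cast; ring

end General

end Regret

/-! ### From the sufficiency property to covariance; affine extension. -/

namespace Regret

section General

variable {E : Type*} [AddCommGroup E] [Module ℝ E] {S : Set E}

theorem tendsto_slope_comp {f : ℝ → ℝ} {s a : ℝ} (r : ℝ) {T : Set ℝ}
    (hf : HasDerivWithinAt f a T s) (hT : ∀ u, 0 < u → s + u * r ∈ T) :
    Tendsto (fun u => u⁻¹ * (f (s + u * r) - f s)) (𝓝[>] 0) (𝓝 (r * a)) := by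
  have h1 : HasDerivWithinAt (fun u : ℝ => s + u * r) r (Set.Ioi 0) 0 := by
    simpa using (((hasDerivAt_id (0 : ℝ)).mul_const r).const_add s).hasDerivWithinAt
  have h2 : HasDerivWithinAt (fun u : ℝ => f (s + u * r)) (r * a) (Set.Ioi 0) 0 :=
    HasDerivWithinAt.scomp (h := fun u : ℝ => s + u * r) (g₁ := f) (0 : ℝ) (by simpa using hf) h1
      (fun u hu => hT u hu)
  rw [hasDerivWithinAt_iff_tendsto_slope' (by simp)] at h2
  refine h2.congr fun u => ?_
  simp [slope]

/-- Two convex functions on the unit interval with the same Bregman divergence differ by an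
affine function. -/
theorem eq_affine_of_bregman_eq {f g : ℝ → ℝ} (hf : ConvexOn ℝ (Set.Icc 0 1) f)
    (hg : ConvexOn ℝ (Set.Icc 0 1) g)
    (h : ∀ s ∈ Set.Ioo (0 : ℝ) 1, ∀ t ∈ Set.Icc (0 : ℝ) 1, ∀ m m' : ℝ,
      Tendsto (fun u => u⁻¹ * (f (s + u * (t - s)) - f s)) (𝓝[>] 0) (𝓝 m) →
      Tendsto (fun u => u⁻¹ * (g (s + u * (t - s)) - g s)) (𝓝[>] 0) (𝓝 m') →
      f t - f s - m = g t - g s - m')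
    {t : ℝ} (ht : t ∈ Set.Icc (0 : ℝ) 1) :
    f t - g t = (1 - t) * (f 0 - g 0) + t * (f 1 - g 1) := by
  have hint : ∀ s ∈ Set.Ioo (0 : ℝ) 1, s ∈ interior (Set.Icc (0 : ℝ) 1) := fun s hs => by
    rwa [interior_Icc]
  have hr : ∀ s ∈ Set.Ioo (0 : ℝ) 1, ∃ c, ∀ t ∈ Set.Icc s 1,
      f t - g t = f s - g s + (t - s) * c := fun s hs => by
    refine ⟨derivWithin f (Set.Ioi s) s - derivWithin g (Set.Ioi s) s, fun t ht => ?_⟩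
    rcases ht.1.eq_or_lt with rfl | hlt
    · ring
    have := h s hs t ⟨hs.1.le.trans ht.1, ht.2⟩ _ _
      (tendsto_slope_comp (t - s) (hf.hasDerivWithinAt_rightDeriv_of_mem_interior (hint s hs))
        fun u hu => by simp only [Set.mem_Ioi]; nlinarith)
      (tendsto_slope_comp (t - s) (hg.hasDerivWithinAt_rightDeriv_of_mem_interior (hint s hs))
        fun u hu => by simp only [Set.mem_Ioi]; nlinarith)
    linarith
  have hl : ∀ s ∈ Set.Ioo (0 : ℝ) 1, ∃ c, ∀ t ∈ Set.Icc 0 s,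
      f t - g t = f s - g s + (t - s) * c := fun s hs => by
    refine ⟨derivWithin f (Set.Iio s) s - derivWithin g (Set.Iio s) s, fun t ht => ?_⟩
    rcases ht.2.eq_or_lt with rfl | hlt
    · ring
    have := h s hs t ⟨ht.1, ht.2.trans hs.2.le⟩ _ _
      (tendsto_slope_comp (t - s) (hf.hasDerivWithinAt_leftDeriv_of_mem_interior (hint s hs))
        fun u hu => by simp only [Set.mem_Iio]; nlinarith)
      (tendsto_slope_comp (t - s) (hg.hasDerivWithinAt_leftDeriv_of_mem_interior (hint s hs))
        fun u hu => by simp only [Set.mem_Iio]; nlinarith)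
    linarith
  rcases ht.1.eq_or_lt with rfl | h0
  · ring
  rcases ht.2.eq_or_lt with rfl | h1
  · ring
  -- Based at `t / 2`, right derivatives make the difference affine on [t/2, 1]; based at `t`, left
  -- derivatives do so on [0, t]. The overlap [t/2, t] forces equal slopes, and the end points 0 and
  -- 1 are reached without differentiating there.
  obtain ⟨c, hc⟩ := hr (t / 2) ⟨by linarith, by linarith⟩
  obtain ⟨d, hd⟩ := hl t ⟨h0, h1⟩
  have e1 := hc t ⟨by linarith, h1.le⟩
  have e2 := hc 1 ⟨by linarith, le_rfl⟩
  have e3 := hd 0 ⟨le_rfl, h0.le⟩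
  have e4 := hd (t / 2) ⟨by linarith, by linarith⟩
  have hcd : c = d := by
    have : t * (c - d) = 0 := by linarith
    rcases mul_eq_zero.1 this with h | h <;> linarith
  subst hcd
  rw [e2, e3, e1]
  ring

/-- `f` is covariant with respect to a class of transformations if `f ∘ Φ - f` is affine on every
segment whose end points can be recovered after applying `Φ`. -/
def IsCovariant (K : Set (S → S)) (f : E → ℝ) : Prop :=
  ∀ Φ ∈ K, ∀ Ψ ∈ K, ∀ x y z : S, Ψ (Φ x) = x → Ψ (Φ y) = y → ∀ t : ℝ, 0 ≤ t → t ≤ 1 →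
    (z : E) = (1 - t) • (x : E) + t • (y : E) →
    f (Φ z) - f z = (1 - t) * (f (Φ x) - f x) + t * (f (Φ y) - f y)

theorem convexOn_comp_segment {f : E → ℝ} (hf : ConvexOn ℝ S f) {x y : E} (hx : x ∈ S)
    (hy : y ∈ S) : ConvexOn ℝ (Set.Icc 0 1) fun t : ℝ => f ((1 - t) • x + t • y) := by
  refine ⟨convex_Icc 0 1, fun s hs t ht a b ha hb hab => ?_⟩
  have h := hf.2 (hf.1 hx hy (sub_nonneg.2 hs.2) hs.1 (by ring))
    (hf.1 hx hy (sub_nonneg.2 ht.2) ht.1 (by ring)) ha hb hab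
  convert h using 2
  simp only [smul_eq_mul]
  have : b = 1 - a := by linarith
  subst this
  module

/-- Recovery of the end points implies recovery of all points between them, since both maps are
affine. So the sufficiency property applies to every pair on the segment and equates the Bregman
divergences of `f` and `f ∘ Φ` there. -/
theorem IsPayoff.isCovariant {A : Set (Action S)} {f : E → ℝ} (hf : IsPayoff A f)
    (hS : Convex ℝ S) {K : Set (S → S)}
    (hK : ∀ Φ ∈ K, ∀ x y z : S, ∀ t : ℝ, 0 ≤ t → t ≤ 1 →
      (z : E) = (1 - t) • (x : E) + t • (y : E) →
      (Φ z : E) = (1 - t) • (Φ x : E) + t • (Φ y : E))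
    (hD : SufficiencyProperty K (regret A)) : IsCovariant K f := by
  intro Φ hΦ Ψ hΨ x y z hx hy t h0 h1 hz
  have hmem : ∀ s ∈ Set.Icc (0 : ℝ) 1, (1 - s) • (x : E) + s • (y : E) ∈ S := fun s hs =>
    hS x.2 y.2 (sub_nonneg.2 hs.2) hs.1 (by ring)
  have hrec : ∀ w : S, ∀ s ∈ Set.Icc (0 : ℝ) 1, (w : E) = (1 - s) • (x : E) + s • (y : E) →
      Ψ (Φ w) = w := fun w s hs hw => by
    apply Subtype.ext
    rw [hK Ψ hΨ _ _ _ s hs.1 hs.2 (hK Φ hΦ x y w s hs.1 hs.2 hw), hx, hy, hw]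
  have hΦ' : ∀ w : S, ∀ s ∈ Set.Icc (0 : ℝ) 1, (w : E) = (1 - s) • (x : E) + s • (y : E) →
      (Φ w : E) = (1 - s) • (Φ x : E) + s • (Φ y : E) :=
    fun w s hs hw => hK Φ hΦ x y w s hs.1 hs.2 hw
  have key := eq_affine_of_bregman_eq (convexOn_comp_segment (hf.convexOn hS) (Φ x).2 (Φ y).2)
    (convexOn_comp_segment (hf.convexOn hS) x.2 y.2) ?_ (t := t) ⟨h0, h1⟩
  · simp only [sub_zero, one_smul, zero_smul, add_zero, sub_self, zero_add] at key
    rw [← hz, ← hΦ' z t ⟨h0, h1⟩ hz] at key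
    exact key
  · intro s hs r hr m m' hm hm'
    have hs' := Set.Ioo_subset_Icc_self hs
    have e := hD Φ hΦ ⟨_, hmem r hr⟩ ⟨_, hmem s hs'⟩ ⟨Ψ, hΨ, fun θ => by
      fin_cases θ
      · exact hrec _ r hr rfl
      · exact hrec _ s hs' rfl⟩
    have e1 := hΦ' ⟨_, hmem r hr⟩ r hr rfl
    have e2 := hΦ' ⟨_, hmem s hs'⟩ s hs' rfl
    rw [hf.regret_eq hS _ _ (m := m), hf.regret_eq hS _ _ (m := m')] at e
    · rw [e1, e2] at e
      rw [← EReal.coe_sub, ← EReal.coe_sub] at e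
      exact EReal.coe_injective e
    · refine (EReal.tendsto_coe.2 hm').congr fun u => ?_
      simp only [segmentSlope]
      congr 4
      module
    · refine (EReal.tendsto_coe.2 hm).congr fun u => ?_
      simp only [segmentSlope, e1, e2]
      congr 4
      module

/-- A function that is affine on a convex set extends to an affine function. -/
theorem exists_affineMap_of_affineOn (hS : Convex ℝ S) (f : E → ℝ)
    (hf : ∀ x ∈ S, ∀ y ∈ S, ∀ t : ℝ, 0 ≤ t → t ≤ 1 →
      f ((1 - t) • x + t • y) = (1 - t) * f x + t * f y) :
    ∃ ℓ : E →ᵃ[ℝ] ℝ, ∀ x ∈ S, f x = ℓ x := by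
  have hab : ∀ x ∈ S, ∀ y ∈ S, ∀ a b : ℝ, 0 ≤ a → 0 ≤ b → a + b = 1 →
      f (a • x + b • y) = a • f x + b • f y := fun x hx y hy a b ha hb hab => by
    obtain rfl : a = 1 - b := by linarith
    exact hf x hx y hy b hb (by linarith)
  have hcvx : ConvexOn ℝ S f := ⟨hS, fun x hx y hy a b ha hb h => (hab x hx y hy a b ha hb h).le⟩
  have hccv : ConcaveOn ℝ S f := ⟨hS, fun x hx y hy a b ha hb h => (hab x hx y hy a b ha hb h).ge⟩
  have hsum : ∀ (u : Finset S) (w : S → ℝ), (∀ i ∈ u, 0 ≤ w i) → ∑ i ∈ u, w i = 1 →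
      f (∑ i ∈ u, w i • (i : E)) = ∑ i ∈ u, w i * f i := fun u w h0 h1 =>
    le_antisymm (hcvx.map_sum_le h0 h1 fun i _ => i.2) (hccv.le_map_sum h0 h1 fun i _ => i.2)
  have hscale : ∀ (u : Finset S) (w : S → ℝ), (∀ i ∈ u, 0 ≤ w i) → 0 < ∑ i ∈ u, w i →
      (∑ i ∈ u, w i) * f ((∑ i ∈ u, w i)⁻¹ • ∑ i ∈ u, w i • (i : E)) = ∑ i ∈ u, w i * f i := by
    intro u w h0 h1
    have := hsum u (fun i => (∑ i ∈ u, w i)⁻¹ * w i) (fun i hi => mul_nonneg (by positivity)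
      (h0 i hi)) (by rw [← Finset.mul_sum, inv_mul_cancel₀ h1.ne'])
    simp_rw [mul_smul, ← Finset.smul_sum, mul_assoc, ← Finset.mul_sum] at this
    rw [this, mul_inv_cancel_left₀ h1.ne']
  -- The extra coordinate records total mass, so that the kernel of `T` consists of the affine
  -- relations among points of `S`. Once `φ` kills that kernel it factors through `T`, which yields
  -- the affine extension.
  let T : (S →₀ ℝ) →ₗ[ℝ] E × ℝ :=
    (Finsupp.linearCombination ℝ fun s : S => (s : E)).prod
      (Finsupp.linearCombination ℝ fun _ : S => (1 : ℝ))
  let φ : (S →₀ ℝ) →ₗ[ℝ] ℝ := Finsupp.linearCombination ℝ fun s : S => f s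
  have hker : φ ∈ (LinearMap.ker T).dualAnnihilator := by
    rw [Submodule.mem_dualAnnihilator]
    intro c hc
    have hc' : c.sum (fun s r => r • (s : E)) = 0 ∧ c.sum (fun _ r => r) = 0 := by
      have := LinearMap.mem_ker.1 hc
      simpa [T, Finsupp.linearCombination_apply, Prod.ext_iff] using this
    have h1 : ∑ s ∈ c.support, c s • (s : E) = 0 := hc'.1
    have h2 : ∑ s ∈ c.support, c s = 0 := hc'.2
    have h3 : φ c = ∑ s ∈ c.support, c s * f s := by
      simp [φ, Finsupp.linearCombination_apply, Finsupp.sum]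
    rw [h3]
    -- The positive and negative parts of a relation have equal mass and equal barycentre. After
    -- normalization they are two convex combinations of the same point, at which `f` has one value.
    have hsplit : ∀ s, c s = max (c s) 0 - max (-c s) 0 := fun s => by
      rcases le_total (c s) 0 with h | h
      · rw [max_eq_right h, max_eq_left (by linarith)]; ring
      · rw [max_eq_left h, max_eq_right (by linarith)]; ring
    have e1 : ∑ s ∈ c.support, max (c s) 0 • (s : E) = ∑ s ∈ c.support, max (-c s) 0 • (s : E) := by
      rw [← sub_eq_zero, ← Finset.sum_sub_distrib, ← h1]
      exact Finset.sum_congr rfl fun s _ => by rw [← sub_smul, ← hsplit]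
    have e2 : ∑ s ∈ c.support, max (c s) 0 = ∑ s ∈ c.support, max (-c s) 0 := by
      rw [← sub_eq_zero, ← Finset.sum_sub_distrib]
      exact (Finset.sum_congr rfl fun s _ => (hsplit s).symm).trans h2
    have e3 : ∑ s ∈ c.support, c s * f s =
        ∑ s ∈ c.support, max (c s) 0 * f s - ∑ s ∈ c.support, max (-c s) 0 * f s := by
      rw [← Finset.sum_sub_distrib]
      exact Finset.sum_congr rfl fun s _ => by rw [← sub_mul, ← hsplit]
    rw [e3, sub_eq_zero]
    rcases (Finset.sum_nonneg fun s (_ : s ∈ c.support) => le_max_right (c s) 0).eq_or_lt with h | h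
    · have z1 := (Finset.sum_eq_zero_iff_of_nonneg fun s _ => le_max_right (c s) 0).1 h.symm
      have z2 := (Finset.sum_eq_zero_iff_of_nonneg fun s _ => le_max_right (-c s) 0).1
        (e2 ▸ h.symm)
      rw [Finset.sum_eq_zero fun s hs => by rw [z1 s hs, zero_mul],
        Finset.sum_eq_zero fun s hs => by rw [z2 s hs, zero_mul]]
    · rw [← hscale _ _ (fun s _ => le_max_right (c s) 0) h,
        ← hscale _ _ (fun s _ => le_max_right (-c s) 0) (e2 ▸ h), e1, e2]
  rw [← LinearMap.range_dualMap_eq_dualAnnihilator_ker] at hker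
  obtain ⟨g, hg⟩ := hker
  refine ⟨(g.comp (LinearMap.inl ℝ E ℝ)).toAffineMap + AffineMap.const ℝ E (g (0, 1)),
    fun x hx => ?_⟩
  have h1 : g (T (Finsupp.single ⟨x, hx⟩ 1)) = φ (Finsupp.single ⟨x, hx⟩ 1) :=
    congrArg (fun ψ => ψ (Finsupp.single ⟨x, hx⟩ 1)) hg
  have h2 : T (Finsupp.single ⟨x, hx⟩ 1) = (x, 0) + (0, 1) := by simp [T]
  have h3 : φ (Finsupp.single ⟨x, hx⟩ 1) = f x := by simp [φ]
  rw [← h3, ← h1, h2, map_add]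
  simp

end General

end Regret

/-! ### The fundamental equation of information. -/

namespace Regret

/-- A monotone completely additive function on the positive integers is proportional to the
logarithm. -/
theorem eq_mul_log_of_monotone_of_additive {L : ℕ → ℝ}
    (hmono : ∀ m n, 1 ≤ m → m ≤ n → L m ≤ L n)
    (hmul : ∀ m n, 1 ≤ m → 1 ≤ n → L (m * n) = L m + L n) :
    ∃ c : ℝ, 0 ≤ c ∧ ∀ n, 1 ≤ n → L n = c * Real.log n := by
  have hL1 : L 1 = 0 := by have := hmul 1 1 le_rfl le_rfl; simp at this; exact this
  have hpow : ∀ n, 1 ≤ n → ∀ k : ℕ, L (n ^ k) = k * L n := fun n hn k => by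
    induction k with
    | zero => simp [hL1]
    | succ k ih =>
      rw [pow_succ, hmul _ _ (Nat.one_le_pow _ _ hn) hn, ih]
      push_cast; ring
  have h2 : 0 ≤ L 2 := hL1 ▸ hmono 1 2 le_rfl (by norm_num)
  have hlog2 : 0 < Real.log 2 := Real.log_pos (by norm_num)
  refine ⟨L 2 / Real.log 2, by positivity, fun n hn => ?_⟩
  -- Sandwiching `n ^ k` between consecutive powers of 2 gives a bound independent of `k`, so the
  -- quantity multiplied by `k` must vanish.
  have key : ∀ k : ℕ, k * |L n * Real.log 2 - L 2 * Real.log n| ≤ L 2 * Real.log 2 := fun k => by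
    have hnk : n ^ k ≠ 0 := by positivity
    set j := Nat.log 2 (n ^ k)
    have a1 : 2 ^ j ≤ n ^ k := Nat.pow_log_le_self 2 hnk
    have a2 : n ^ k ≤ 2 ^ (j + 1) := (Nat.lt_pow_succ_log_self (by norm_num) _).le
    have b1 := hmono _ _ (Nat.one_le_pow _ _ (by norm_num)) a1
    have b2 := hmono _ _ (Nat.one_le_pow _ _ hn) a2
    rw [hpow 2 (by norm_num), hpow n hn] at b1 b2
    have c1 : (j : ℝ) * Real.log 2 ≤ k * Real.log n := by
      rw [← Real.log_pow, ← Real.log_pow]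
      exact Real.log_le_log (by positivity) (by exact_mod_cast a1)
    have c2 : (k : ℝ) * Real.log n ≤ (j + 1 : ℕ) * Real.log 2 := by
      rw [← Real.log_pow, ← Real.log_pow]
      exact Real.log_le_log (by positivity) (by exact_mod_cast a2)
    push_cast at b2 c2
    rw [← abs_of_nonneg (k.cast_nonneg (α := ℝ)), ← abs_mul, abs_le]
    have d1 := mul_le_mul_of_nonneg_right b1 hlog2.le
    have d2 := mul_le_mul_of_nonneg_right b2 hlog2.le
    have d3 := mul_le_mul_of_nonneg_left c1 h2
    have d4 := mul_le_mul_of_nonneg_left c2 h2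
    constructor <;> linarith
  have hz : |L n * Real.log 2 - L 2 * Real.log n| = 0 := by
    by_contra hne
    have hpos := (abs_nonneg _).lt_of_ne' hne
    obtain ⟨k, hk⟩ := exists_nat_gt (L 2 * Real.log 2 / |L n * Real.log 2 - L 2 * Real.log n|)
    rw [div_lt_iff₀ hpos] at hk
    exact absurd (key k) (not_le.2 hk)
  have := sub_eq_zero.1 (abs_eq_zero.1 hz)
  field_simp
  linarith

/-- A convex solution of the fundamental equation of information is a multiple of the binary
entropy. -/
theorem exists_eq_neg_mul_binEntropy {h : ℝ → ℝ} (hc : ConvexOn ℝ (Set.Icc 0 1) h) (h0 : h 0 = 0)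
    (h1 : h 1 = 0) (hs : ∀ x ∈ Set.Icc (0 : ℝ) 1, h (1 - x) = h x)
    (hF : ∀ x y z : ℝ, 0 < x → 0 < y → 0 < z → x + y + z = 1 →
      h (x + y) + (x + y) * h (x / (x + y)) = h x + (y + z) * h (y / (y + z))) :
    ∃ c : ℝ, 0 ≤ c ∧ ∀ x ∈ Set.Icc (0 : ℝ) 1, h x = -c * Real.binEntropy x := by
  -- The homogeneous extension of `h`, the price of splitting a mass into `x` and `y`. In these
  -- terms the equation is a 2-cocycle identity, and `φ` below, summed from the increments `-G k 1`,
  -- exhibits `G` as a coboundary on positive integers.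
  set G : ℝ → ℝ → ℝ := fun x y => (x + y) * h (x / (x + y)) with hG
  have hcocycle : ∀ a b c : ℝ, 0 < a → 0 < b → 0 < c →
      G (a + b) c + G a b = G a (b + c) + G b c := fun a b c ha hb hc => by
    have hN : 0 < a + b + c := by positivity
    have := hF (a / (a + b + c)) (b / (a + b + c)) (c / (a + b + c)) (by positivity)
      (by positivity) (by positivity) (by field_simp)
    rw [← add_div, ← add_div, div_div_div_cancel_right₀ hN.ne',
      div_div_div_cancel_right₀ hN.ne'] at this
    simp only [hG]
    rw [← add_assoc a b c]
    field_simp at this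
    linarith
  have hhom : ∀ k a b : ℝ, 0 < k → 0 < a → 0 < b → G (k * a) (k * b) = k * G a b :=
    fun k a b hk ha hb => by
      simp only [hG]
      rw [← mul_add, mul_div_mul_left _ _ hk.ne', mul_assoc]
  set g : ℕ → ℝ := fun k => -G k 1 with hg
  set φ : ℕ → ℝ := fun n => ∑ k ∈ Finset.range n, g k with hφ
  have hφs : ∀ n, φ (n + 1) = φ n + g n := fun n => Finset.sum_range_succ _ _
  have hφ1 : φ 1 = 0 := by simp [hφ, hg, hG, h0]
  have hGφ : ∀ m n : ℕ, 1 ≤ m → 1 ≤ n → G m n = φ m + φ n - φ (m + n) := fun m n hm hn => by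
    induction n, hn using Nat.le_induction with
    | base => rw [hφs m, hφ1]; simp [hg]
    | succ n hn ih =>
      have hm' : (0 : ℝ) < m := by exact_mod_cast hm
      have hn' : (0 : ℝ) < n := by exact_mod_cast hn
      have := hcocycle m n 1 hm' hn' one_pos
      have e1 : g (m + n) = -G (m + n) 1 := by simp [hg]
      have e2 : g n = -G n 1 := rfl
      rw [← add_assoc, hφs, hφs, e1, e2]
      push_cast
      linarith
  -- Homogeneity of `G` forces this Leibniz rule, that is, complete additivity of `φ n / n`.
  have hφmul : ∀ k n : ℕ, 1 ≤ k → 1 ≤ n → φ (k * n) = k * φ n + n * φ k := fun k n hk hn => by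
    induction n, hn using Nat.le_induction with
    | base => simp [hφ1]
    | succ n hn ih =>
      have hk' : (0 : ℝ) < k := by exact_mod_cast hk
      have hn' : (0 : ℝ) < n := by exact_mod_cast hn
      have e1 := hGφ (k * n) k (Nat.mul_pos hk hn) hk
      have e2 := hhom k n 1 hk' hn' one_pos
      have e3 := hGφ n 1 hn le_rfl
      rw [mul_add, mul_one]
      push_cast at e1 e2 e3 ⊢
      rw [mul_one] at e2
      rw [e2, e3, hφ1] at e1
      linarith
  have hle : ∀ x ∈ Set.Icc (0 : ℝ) 1, ∀ t ∈ Set.Icc (0 : ℝ) 1, h (t * x) ≤ t * h x :=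
    fun x hx t ht => by
      have := hc.2 (Set.left_mem_Icc.2 zero_le_one) hx (sub_nonneg.2 ht.2) ht.1 (by ring)
      simpa [h0] using this
  have hgval : ∀ k : ℕ, g k = -((k + 1) * h (1 / (k + 1))) := fun k => by
    simp only [hg, hG]
    rw [← hs (1 / ((k : ℝ) + 1)) ⟨by positivity, by
      rw [div_le_one (by positivity)]; linarith [k.cast_nonneg (α := ℝ)]⟩]
    congr 3
    field_simp
    ring
  -- Convexity with `h 0 = 0` makes `h x / x` nondecreasing, so the increments of `φ` increase and
  -- the averages `φ n / n` do too. This is the regularity that singles out the logarithm.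
  have hgmono : Monotone g := monotone_nat_of_le_succ fun k => by
    rw [hgval, hgval]
    have hk : (0 : ℝ) < k + 1 := by positivity
    have := hle (1 / (k + 1)) ⟨by positivity, by
      rw [div_le_one (by positivity)]; linarith [k.cast_nonneg (α := ℝ)]⟩ ((k + 1) / (k + 2))
      ⟨by positivity, by rw [div_le_one (by positivity)]; linarith⟩
    have e : ((k : ℝ) + 1) / (k + 2) * (1 / (k + 1)) = 1 / (k + 2) := by field_simp
    rw [e, div_mul_eq_mul_div, le_div_iff₀ (by positivity)] at this
    push_cast
    rw [show (k : ℝ) + 1 + 1 = k + 2 by ring]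
    linarith
  have hφle : ∀ n : ℕ, φ n ≤ n * g n := fun n => by
    have := Finset.sum_le_card_nsmul (Finset.range n) g (g n)
      fun k hk => hgmono (Finset.mem_range.1 hk).le
    simpa using this
  obtain ⟨c, hc0, hcL⟩ := eq_mul_log_of_monotone_of_additive (L := fun n => φ n / n)
    (fun m n hm hmn => by
      induction n, hmn using Nat.le_induction with
      | base => exact le_rfl
      | succ n hn ih =>
        refine ih.trans ?_
        have hn' : (0 : ℝ) < n := by exact_mod_cast hm.trans hn
        rw [div_le_div_iff₀ hn' (by positivity), hφs]
        push_cast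
        have := hφle n
        linarith)
    (fun m n hm hn => by
      have hm' : (0 : ℝ) < m := by exact_mod_cast hm
      have hn' : (0 : ℝ) < n := by exact_mod_cast hn
      rw [hφmul m n hm hn]
      push_cast
      field_simp
      ring)
  have hφlog : ∀ n : ℕ, 1 ≤ n → φ n = c * (n * Real.log n) := fun n hn => by
    have hn' : (0 : ℝ) < n := by exact_mod_cast hn
    have := hcL n hn
    rw [div_eq_iff hn'.ne'] at this
    rw [this]; ring
  have hrat : ∀ m n : ℕ, 1 ≤ m → 1 ≤ n →
      h (m / (m + n)) = -c * Real.binEntropy (m / (m + n)) := fun m n hm hn => by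
    have hm' : (0 : ℝ) < m := by exact_mod_cast hm
    have hn' : (0 : ℝ) < n := by exact_mod_cast hn
    have e := hGφ m n hm hn
    rw [hφlog m hm, hφlog n hn, hφlog (m + n) (by omega)] at e
    simp only [hG] at e
    rw [Real.binEntropy, show 1 - (m : ℝ) / (m + n) = n / (m + n) by field_simp; ring, inv_div,
      inv_div, Real.log_div (by positivity) (by positivity),
      Real.log_div (by positivity) (by positivity)]
    push_cast at e
    have hmn : (0 : ℝ) < m + n := by positivity
    refine mul_left_cancel₀ hmn.ne' (e.trans ?_)
    field_simp
    ring
  refine ⟨c, hc0, fun x hx => ?_⟩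
  rcases hx.1.eq_or_lt with rfl | hx0
  · simp [h0]
  rcases hx.2.eq_or_lt with rfl | hx1
  · simp [h1]
  -- A convex function is continuous only in the interior, so density of the rationals is used on
  -- (0, 1) and the end points were settled before.
  have heq : Set.EqOn h (fun x => -c * Real.binEntropy x)
      (Set.Ioo 0 1 ∩ Set.range ((↑) : ℚ → ℝ)) := by
    rintro _ ⟨⟨hq0, hq1⟩, q, rfl⟩
    have q0 : 0 < q := by exact_mod_cast hq0
    have q1 : q < 1 := by exact_mod_cast hq1
    obtain ⟨m, hm⟩ := Int.eq_ofNat_of_zero_le (Rat.num_nonneg.2 q0.le)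
    have hlt : q.num < q.den := Rat.num_lt_denom_iff.2 q1
    have hmpos : 0 < q.num := Rat.num_pos.2 q0
    have hd : ((m : ℝ) + ((q.den - m : ℕ) : ℝ)) = q.den := by
      rw [Nat.cast_sub (by omega)]; ring
    have hqe : (q : ℝ) = (m : ℝ) / (m + ((q.den - m : ℕ) : ℝ)) := by
      rw [hd, Rat.cast_def, hm]; simp
    rw [hqe]
    exact hrat m (q.den - m) (by omega) (by omega)
  refine heq.of_subset_closure ?_ (by fun_prop) Set.inter_subset_left
    (Rat.denseRange_cast.open_subset_closure_inter isOpen_Ioo) ⟨hx0, hx1⟩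
  have := hc.continuousOn_interior
  rwa [interior_Icc] at this

end Regret

/-! ### Classical state spaces: grouping and Shannon entropy. -/

namespace Regret

/-- A class of transformations consists of affine maps. -/
def IsAffineClass {E : Type*} [AddCommGroup E] [Module ℝ E] {S : Set E} (K : Set (S → S)) : Prop :=
  ∀ Φ ∈ K, ∀ x y z : S, ∀ t : ℝ, 0 ≤ t → t ≤ 1 → (z : E) = (1 - t) • (x : E) + t • (y : E) →
    (Φ z : E) = (1 - t) • (Φ x : E) + t • (Φ y : E)

theorem IsCovariant.sub_linearMap {E : Type*} [AddCommGroup E] [Module ℝ E] {S : Set E}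
    {K : Set (S → S)} {f : E → ℝ} (hf : IsCovariant K f) (hK : IsAffineClass K) (ℓ : E →ₗ[ℝ] ℝ) :
    IsCovariant K fun x => f x - ℓ x := by
  intro Φ hΦ Ψ hΨ x y z hx hy t h0 h1 hz
  have e := hf Φ hΦ Ψ hΨ x y z hx hy t h0 h1 hz
  have e1 := congrArg ℓ hz
  have e2 := congrArg ℓ (hK Φ hΦ x y z t h0 h1 hz)
  simp only [map_add, map_smul, smul_eq_mul] at e1 e2
  simp only
  rw [e1, e2]
  linarith

theorem shannonEntropy_eq {ι : Type*} [Fintype ι] (p : stdSimplex ℝ ι) :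
    shannonEntropy p = ∑ i, Real.negMulLog (p.1 i) := rfl

section Classical

variable {ι : Type*} [Fintype ι] [DecidableEq ι]

theorem isAffineClass_classicalTransformations :
    IsAffineClass (classicalTransformations ι) := by
  rintro Φ ⟨T, -, hT⟩ x y z t - - hz
  have hT : ∀ p, (Φ p).1 = T.mulVec p.1 := hT
  rw [hT, hT, hT, hz, Matrix.mulVec_add, Matrix.mulVec_smul, Matrix.mulVec_smul]

/-- The extreme points of the simplex. -/
def vertex (i : ι) : stdSimplex ℝ ι := ⟨Pi.single i 1, single_mem_stdSimplex ℝ i⟩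

/-- The transformation of the simplex that sends the extreme point `i` to `col i`. -/
def kernelMap (col : ι → stdSimplex ℝ ι) (p : stdSimplex ℝ ι) : stdSimplex ℝ ι :=
  ⟨∑ b, p.1 b • (col b).1,
    (convex_stdSimplex ℝ ι).sum_mem (fun b _ => p.2.1 b) p.2.2 fun b _ => (col b).2⟩

theorem kernelMap_mem (col : ι → stdSimplex ℝ ι) : kernelMap col ∈ classicalTransformations ι := by
  refine ⟨Matrix.of fun a b => (col b).1 a, ?_, fun p => ?_⟩
  · rw [Matrix.mem_colStochastic_iff_sum]
    exact ⟨fun i j => (col j).2.1 i, fun j => (col j).2.2⟩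
  · change (kernelMap col p).1 = _
    funext a
    simp only [kernelMap, Matrix.mulVec, dotProduct, Matrix.of_apply, Finset.sum_apply,
      Pi.smul_apply, smul_eq_mul]
    exact Finset.sum_congr rfl fun b _ => mul_comm _ _

theorem kernelMap_vertex (col : ι → stdSimplex ℝ ι) (i : ι) :
    kernelMap col (vertex i) = col i := by
  apply Subtype.ext
  simp only [kernelMap, vertex, Pi.single_apply]
  simp

theorem kernelMap_edge (col : ι → stdSimplex ℝ ι) (i j : ι) {θ : ℝ} (z : stdSimplex ℝ ι)
    (h0 : 0 ≤ θ) (h1 : θ ≤ 1)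
    (hz : z.1 = (1 - θ) • (vertex i).1 + θ • (vertex j).1) :
    (kernelMap col z).1 = (1 - θ) • (col i).1 + θ • (col j).1 := by
  have := isAffineClass_classicalTransformations (kernelMap col) (kernelMap_mem col) _ _ z θ h0 h1 hz
  rwa [kernelMap_vertex, kernelMap_vertex] at this

theorem kernelMap_eq_self {col : ι → stdSimplex ℝ ι} {p : stdSimplex ℝ ι}
    (h : ∀ b, p.1 b ≠ 0 → col b = vertex b) : kernelMap col p = p := by
  apply Subtype.ext
  have : ∀ b, p.1 b • (col b).1 = p.1 b • (vertex b).1 := fun b => by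
    by_cases hb : p.1 b = 0
    · rw [hb, zero_smul, zero_smul]
    · rw [h b hb]
  simp only [kernelMap, this]
  funext a
  simp [vertex, Pi.single_apply]

/-- Any two edges are exchanged by stochastic maps that invert each other on their end points. What
happens to the other letters is irrelevant. -/
theorem IsCovariant.edge_eq {g : (ι → ℝ) → ℝ} (hg : IsCovariant (classicalTransformations ι) g)
    (hv : ∀ i, g (vertex i).1 = 0) {i j k l : ι} (hij : i ≠ j) (hkl : k ≠ l) {θ : ℝ} (h0 : 0 ≤ θ)
    (h1 : θ ≤ 1) : g ((1 - θ) • (vertex i).1 + θ • (vertex j).1) =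
      g ((1 - θ) • (vertex k).1 + θ • (vertex l).1) := by
  let z : stdSimplex ℝ ι := ⟨(1 - θ) • (vertex i).1 + θ • (vertex j).1,
    convex_stdSimplex ℝ ι (vertex i).2 (vertex j).2 (sub_nonneg.2 h1) h0 (by ring)⟩
  let c : ι → stdSimplex ℝ ι := fun b => if b = i then vertex k else vertex l
  let d : ι → stdSimplex ℝ ι := fun b => if b = k then vertex i else vertex j
  have e := hg (kernelMap c) (kernelMap_mem c) (kernelMap d) (kernelMap_mem d) (vertex i)
    (vertex j) z (by simp [kernelMap_vertex, c, d]) (by simp [kernelMap_vertex, c, d, hij.symm,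
      hkl.symm]) θ h0 h1 rfl
  rw [kernelMap_edge c i j z h0 h1 rfl, kernelMap_vertex, kernelMap_vertex] at e
  simp only [c, if_true, if_neg hij.symm, hv] at e
  simp only [z] at e
  linarith

/-- The grouping property: two letters can be merged at the price of a conditional term. -/
theorem IsCovariant.grouping {g : (ι → ℝ) → ℝ} (hg : IsCovariant (classicalTransformations ι) g)
    (hv : ∀ i, g (vertex i).1 = 0) {i j : ι} (hij : i ≠ j) {θ : ℝ} (h0 : 0 ≤ θ) (h1 : θ ≤ 1)
    (y : stdSimplex ℝ ι) (hyi : y.1 i = 0) (hyj : y.1 j = 0) {t : ℝ}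
    (ht0 : 0 ≤ t) (ht1 : t ≤ 1) :
    g ((1 - t) • ((1 - θ) • (vertex i).1 + θ • (vertex j).1) + t • y.1) =
      g ((1 - t) • (vertex i).1 + t • y.1) +
        (1 - t) * g ((1 - θ) • (vertex i).1 + θ • (vertex j).1) := by
  let w : stdSimplex ℝ ι := ⟨(1 - θ) • (vertex i).1 + θ • (vertex j).1,
    convex_stdSimplex ℝ ι (vertex i).2 (vertex j).2 (sub_nonneg.2 h1) h0 (by ring)⟩
  let z : stdSimplex ℝ ι := ⟨(1 - t) • w.1 + t • y.1,
    convex_stdSimplex ℝ ι w.2 y.2 (sub_nonneg.2 ht1) ht0 (by ring)⟩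
  -- `c` merges `j` into `i`, and `d` resplits `i` with the known conditional law `w`. Both leave
  -- `y` alone because `y` charges neither letter, so the segment from `w` to `y` is recoverable.
  let c : ι → stdSimplex ℝ ι := fun b => if b = j then vertex i else vertex b
  let d : ι → stdSimplex ℝ ι := fun b => if b = i then w else vertex b
  have hcw : kernelMap c w = vertex i := by
    apply Subtype.ext
    rw [kernelMap_edge c i j w h0 h1 rfl]
    simp only [c, if_true, if_neg hij]
    module
  have hcy : kernelMap c y = y := kernelMap_eq_self fun b hb => by
    simp only [c]; rw [if_neg]; rintro rfl; exact hb hyj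
  have hdy : kernelMap d y = y := kernelMap_eq_self fun b hb => by
    simp only [d]; rw [if_neg]; rintro rfl; exact hb hyi
  have e := hg (kernelMap c) (kernelMap_mem c) (kernelMap d) (kernelMap_mem d) w y z
    (by rw [hcw, kernelMap_vertex]; simp [d]) (by rw [hcy, hdy]) t ht0 ht1 rfl
  rw [isAffineClass_classicalTransformations (kernelMap c) (kernelMap_mem c) w y z t ht0 ht1 rfl,
    hcw, hcy, hv] at e
  simp only [z, w] at e
  linarith

theorem negMulLog_add_negMulLog {a b : ℝ} (ha : 0 < a) (hb : 0 < b) :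
    Real.negMulLog a + Real.negMulLog b =
      Real.negMulLog (a + b) + (a + b) * Real.binEntropy (b / (a + b)) := by
  have hab : 0 < a + b := by positivity
  rw [Real.binEntropy, show 1 - b / (a + b) = a / (a + b) by field_simp; ring, inv_div, inv_div,
    Real.log_div (by positivity) (by positivity), Real.log_div (by positivity) (by positivity)]
  simp only [Real.negMulLog]
  field_simp
  ring

/-- The third letter makes the fundamental equation available on an edge. Grouping and the chain
rule for entropy then reduce any distribution to one with smaller support. -/
theorem exists_eq_neg_mul_shannonEntropy (hcard : 3 ≤ Fintype.card ι) {f : (ι → ℝ) → ℝ}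
    (hconv : ConvexOn ℝ (stdSimplex ℝ ι) f)
    (hcov : IsCovariant (classicalTransformations ι) f) :
    ∃ c : ℝ, 0 ≤ c ∧ ∀ p : stdSimplex ℝ ι,
      f p.1 = -c * shannonEntropy p + ∑ i, p.1 i * f (Pi.single i 1) := by
  let ℓ : (ι → ℝ) →ₗ[ℝ] ℝ := ∑ i, f (Pi.single i 1) • LinearMap.proj i
  have hℓ : ∀ x, ℓ x = ∑ i, x i * f (Pi.single i 1) := fun x => by
    simp [ℓ, mul_comm]
  set g : (ι → ℝ) → ℝ := fun x => f x - ℓ x with hgdef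
  have hg : IsCovariant (classicalTransformations ι) g :=
    hcov.sub_linearMap isAffineClass_classicalTransformations ℓ
  have hgc : ConvexOn ℝ (stdSimplex ℝ ι) g :=
    hconv.sub (ℓ.concaveOn (convex_stdSimplex ℝ ι))
  have hv : ∀ i, g (vertex i).1 = 0 := fun i => by
    simp [hgdef, hℓ, vertex, Pi.single_apply]
  obtain ⟨i₀, j₀, k₀, hij, hik, hjk⟩ := Fintype.two_lt_card_iff.1 (show 2 < Fintype.card ι by omega)
  have hthird : ∀ i j : ι, ∃ k, k ≠ i ∧ k ≠ j := fun i j => by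
    by_contra! h
    have h1 := h i₀
    have h2 := h j₀
    have h3 := h k₀
    by_cases a : i₀ = i
    · subst a
      exact hjk ((h2 hij.symm).trans (h3 hik.symm).symm)
    · by_cases b : j₀ = i
      · subst b
        exact hik ((h1 a).trans (h3 hjk.symm).symm)
      · exact hij ((h1 a).trans (h2 b).symm)
  set h : ℝ → ℝ := fun θ => g ((1 - θ) • (vertex i₀).1 + θ • (vertex j₀).1) with hh
  have hedge : ∀ i j, i ≠ j → ∀ θ, 0 ≤ θ → θ ≤ 1 →
      g ((1 - θ) • (vertex i).1 + θ • (vertex j).1) = h θ :=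
    fun i j hne θ h0 h1 => hg.edge_eq hv hne hij h0 h1
  have hsymm : ∀ x ∈ Set.Icc (0 : ℝ) 1, h (1 - x) = h x := fun x hx => by
    rw [← hedge j₀ i₀ hij.symm x hx.1 hx.2]
    simp only [hh, sub_sub_cancel]
    rw [add_comm]
  obtain ⟨c, hc0, hc⟩ := exists_eq_neg_mul_binEntropy (h := h)
    (convexOn_comp_segment hgc (vertex i₀).2 (vertex j₀).2) (by simp [hh, hv]) (by simp [hh, hv])
    hsymm (fun x y z hx hy hz hsum => by
      -- merge the last two letters, or the first two
      have hy0 : ∀ a b : ι, a ≠ b → (vertex a).1 b = 0 := fun a b hab => by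
        simp [vertex, hab.symm]
      have e1 := hg.grouping hv hij.symm (θ := x / (x + y)) (by positivity)
        (by rw [div_le_one (by positivity)]; linarith) (vertex k₀) (hy0 _ _ hjk.symm)
        (hy0 _ _ hik.symm) hz.le (by linarith)
      have e2 := hg.grouping hv hjk.symm (θ := y / (y + z)) (by positivity)
        (by rw [div_le_one (by positivity)]; linarith) (vertex i₀) (hy0 _ _ hik)
        (hy0 _ _ hij) hx.le (by linarith)
      rw [hedge _ _ hij.symm _ (by positivity) (by rw [div_le_one (by positivity)]; linarith),
        hedge _ _ hjk _ hz.le (by linarith)] at e1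
      rw [hedge _ _ hjk.symm _ (by positivity) (by rw [div_le_one (by positivity)]; linarith),
        hedge _ _ hik.symm _ hx.le (by linarith)] at e2
      rw [← hsymm z ⟨hz.le, by linarith⟩] at e1
      rw [show 1 - z = x + y by linarith] at e1
      rw [show 1 - x = y + z by linarith] at e2
      rw [← e1, ← e2]
      -- Both groupings start from the distribution with masses x, y, z on `i₀`, `j₀`, `k₀`.
      congr 1
      have q1 : (x + y) * (1 - x / (x + y)) = y := by field_simp; ring
      have q2 : (x + y) * (x / (x + y)) = x := by field_simp
      have q3 : (y + z) * (1 - y / (y + z)) = z := by field_simp; ring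
      have q4 : (y + z) * (y / (y + z)) = y := by field_simp
      simp only [smul_add, smul_smul, q1, q2, q3, q4]
      abel)
  have main : ∀ n : ℕ, ∀ p : stdSimplex ℝ ι,
      (Finset.univ.filter fun i => p.1 i ≠ 0).card = n →
      g p.1 = -c * shannonEntropy p := by
    intro n
    induction n using Nat.strong_induction_on with
    | _ n ih =>
    intro p hp
    by_cases hex : ∃ i j, i ≠ j ∧ p.1 i ≠ 0 ∧ p.1 j ≠ 0
    · obtain ⟨i, j, hne, hi, hj⟩ := hex
      have hi' : 0 < p.1 i := (p.2.1 i).lt_of_ne' hi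
      have hj' : 0 < p.1 j := (p.2.1 j).lt_of_ne' hj
      set s := p.1 i + p.1 j with hs
      have hs0 : 0 < s := by positivity
      have hs1 : s ≤ 1 := by
        rw [hs, ← p.2.2, ← Finset.sum_pair hne]
        exact Finset.sum_le_sum_of_subset_of_nonneg (Finset.subset_univ _) fun a _ _ => p.2.1 a
      obtain ⟨y, hyi, hyj, hy⟩ : ∃ y : stdSimplex ℝ ι, y.1 i = 0 ∧ y.1 j = 0 ∧
          (1 - s) • y.1 = p.1 - (p.1 i • (vertex i).1 +
            p.1 j • (vertex j).1) := by
        set r : ι → ℝ := p.1 - (p.1 i • (vertex i).1 +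
            p.1 j • (vertex j).1) with hr
        have ri : r i = 0 := by simp [hr, vertex, hne]
        have rj : r j = 0 := by simp [hr, vertex, hne.symm]
        have r0 : ∀ a, 0 ≤ r a := fun a => by
          by_cases ha : a = i
          · rw [ha, ri]
          by_cases hb : a = j
          · rw [hb, rj]
          simpa [hr, vertex, ha, hb] using p.2.1 a
        have rs : ∑ a, r a = 1 - s := by
          simp [hr, Finset.sum_add_distrib, p.2.2, vertex, ← Finset.mul_sum, hs]
        -- If `i` and `j` carry all the mass, the remainder has weight 0, and any state avoiding
        -- both letters can serve as `y`; a third letter provides one.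
        rcases hs1.eq_or_lt with h1 | h1
        · obtain ⟨k, hki, hkj⟩ := hthird i j
          refine ⟨vertex k, by simp [vertex, hki.symm], by simp [vertex, hkj.symm], ?_⟩
          rw [h1, sub_self] at rs
          have := (Finset.sum_eq_zero_iff_of_nonneg fun a _ => r0 a).1 rs
          rw [h1, sub_self, zero_smul]
          funext a
          exact (this a (Finset.mem_univ a)).symm
        · have h1' : 0 < 1 - s := by linarith
          refine ⟨⟨(1 - s)⁻¹ • r, fun a => mul_nonneg (by positivity) (r0 a), ?_⟩, ?_, ?_, ?_⟩
          · simp only [Pi.smul_apply, smul_eq_mul]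
            rw [← Finset.mul_sum, rs, inv_mul_cancel₀ h1'.ne']
          · simp [ri]
          · simp [rj]
          · simp only [smul_smul, mul_inv_cancel₀ h1'.ne', one_smul]
      have e := hg.grouping hv hne (θ := p.1 j / s) (by positivity)
        (by rw [div_le_one hs0]; linarith) y hyi hyj (t := 1 - s) (by linarith) (by linarith)
      rw [hedge _ _ hne _ (by positivity) (by rw [div_le_one hs0]; linarith), hy] at e
      have q1 : s * (1 - p.1 j / s) = p.1 i := by field_simp; rw [hs]; ring
      have q2 : s * (p.1 j / s) = p.1 j := by field_simp
      simp only [sub_sub_cancel, smul_add, smul_smul, q1, q2] at e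
      rw [add_sub_cancel, hc _ ⟨by positivity, by rw [div_le_one hs0]; linarith⟩] at e
      let p' : stdSimplex ℝ ι := ⟨s • (vertex i).1 + (1 - s) • y.1,
        convex_stdSimplex ℝ ι (vertex i).2 y.2 hs0.le (sub_nonneg.2 hs1) (by ring)⟩
      have hp'eq : p'.1 = s • (vertex i).1 + (p.1 -
          (p.1 i • (vertex i).1 + p.1 j • (vertex j).1)) := by
        simp only [p', hy]
      rw [← hp'eq] at e
      have pi' : p'.1 i = s := by rw [hp'eq]; simp [vertex, hne]
      have pj' : p'.1 j = 0 := by rw [hp'eq]; simp [vertex, hne.symm]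
      have po' : ∀ a, a ≠ i → a ≠ j → p'.1 a = p.1 a := fun a ha hb => by
        rw [hp'eq]; simp [vertex, ha, hb]
      have hlt : (Finset.univ.filter fun i => p'.1 i ≠ 0).card < n := by
        rw [← hp]
        refine Finset.card_lt_card (Finset.ssubset_iff_of_subset ?_ |>.2 ⟨j, by simpa using hj,
          by simpa using pj'⟩)
        intro a ha
        simp only [Finset.mem_filter, Finset.mem_univ, true_and] at ha ⊢
        by_cases hai : a = i
        · rwa [hai]
        by_cases haj : a = j
        · rwa [haj]
        rwa [← po' a hai haj]
      have hent : shannonEntropy p - shannonEntropy p' =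
          s * Real.binEntropy (p.1 j / s) := by
        rw [shannonEntropy_eq, shannonEntropy_eq]
        rw [← Finset.sum_sub_distrib, Fintype.sum_eq_add i j hne
          fun a ha => by rw [po' a ha.1 ha.2, sub_self], pi', pj', Real.negMulLog_zero]
        have := negMulLog_add_negMulLog hi' hj'
        rw [← hs] at this
        linarith
      rw [e, ih _ hlt p' rfl]
      linear_combination c * hent
    · push Not at hex
      obtain ⟨i, hi⟩ : ∃ i, p.1 i ≠ 0 := by
        by_contra! h0
        have := p.2.2
        simp [h0] at this
      have hp0 : ∀ j, j ≠ i → p.1 j = 0 := fun j hj => hex i j hj.symm hi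
      have hp1 : p.1 i = 1 := by
        rw [← p.2.2]
        exact (Finset.sum_eq_single i (fun j _ hj => hp0 j hj) (by simp)).symm
      have hpe : p = vertex i := by
        apply Subtype.ext
        funext a
        by_cases ha : a = i
        · subst ha; simp [vertex, hp1]
        · simp [vertex, ha, hp0 a ha]
      subst hpe
      rw [hv]
      have : shannonEntropy (vertex i) = 0 := by
        refine Finset.sum_eq_zero fun a _ => ?_
        by_cases ha : a = i
        · subst ha; simp [vertex]
        · simp [vertex, ha]
      rw [this, mul_zero]
  refine ⟨c, hc0, fun p => ?_⟩
  have := main _ p rfl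
  simp only [hgdef] at this
  rw [← hℓ]
  linarith

end Classical

end Regret

/-! ### Quantum transformations and the diagonal embedding of the simplex. -/

namespace Regret

section Quantum

open scoped ComplexOrder Matrix

variable {n : Type*} [Fintype n]

theorem convex_densityMatrices : Convex ℝ (densityMatrices n) := by
  intro x hx y hy a b ha hb hab
  refine ⟨?_, ?_⟩
  · exact (hx.1.smul ha).add (hy.1.smul hb)
  · rw [Matrix.trace_add, Matrix.trace_smul, Matrix.trace_smul, hx.2, hy.2, ← add_smul, hab, one_smul]

variable [DecidableEq n]

open scoped MatrixOrder Matrix.Norms.L2Operator in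
/-- The completely positive map with given Kraus operators. -/
noncomputable def krausCP {κ : Type*} [Fintype κ] (V : κ → Matrix n n ℂ) :
    CompletelyPositiveMap (Matrix n n ℂ) (Matrix n n ℂ) where
  toFun X := ∑ k, V k * X * (V k)ᴴ
  map_add' X Y := by simp [Matrix.mul_add, Matrix.add_mul, Finset.sum_add_distrib]
  map_smul' c X := by simp [Finset.smul_sum]
  map_cstarMatrix_nonneg' m M hM := by
    -- Applying X ↦ W X Wᴴ to every block is conjugation by the block diagonal matrix with blocks
    -- `W`, which preserves positivity at every size.
    have key : ∀ W : Matrix n n ℂ, 0 ≤ M.map fun X => W * X * Wᴴ := fun W => by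
      let D : CStarMatrix (Fin m) (Fin m) (Matrix n n ℂ) :=
        CStarMatrix.ofMatrix (Matrix.diagonal fun _ => W)
      have h := star_right_conjugate_nonneg hM D
      convert h using 1
      ext i j : 2
      rw [CStarMatrix.map_apply, CStarMatrix.mul_apply, Finset.sum_eq_single j]
      · rw [CStarMatrix.mul_apply, Finset.sum_eq_single i]
        · simp [D, CStarMatrix.star_apply, Matrix.star_eq_conjTranspose]
        · intro b _ hb
          simp [D, Matrix.diagonal_apply_ne _ hb.symm]
        · simp
      · intro b _ hb
        simp [D, CStarMatrix.star_apply, Matrix.diagonal_apply_ne _ hb.symm]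
      · simp
    have hsum : M.map (fun X => ∑ k, V k * X * (V k)ᴴ) =
        ∑ k, M.map fun X => V k * X * (V k)ᴴ := by
      ext i j : 2
      have : ∀ s : Finset κ, (∑ k ∈ s, M.map fun X => V k * X * (V k)ᴴ) i j =
          ∑ k ∈ s, V k * M i j * (V k)ᴴ := fun s => by
        classical
        induction s using Finset.induction_on with
        | empty => simp
        | insert a s ha ih => rw [Finset.sum_insert ha, Finset.sum_insert ha,
            CStarMatrix.add_apply, ih]; rfl
      rw [this]; rfl
    change 0 ≤ M.map (fun X => ∑ k, V k * X * (V k)ᴴ)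
    rw [hsum]
    exact Finset.sum_nonneg fun k _ => key (V k)

/-- The quantum transformation with given Kraus operators. -/
noncomputable def krausMap {κ : Type*} [Fintype κ] (V : κ → Matrix n n ℂ)
    (hV : ∑ k, (V k)ᴴ * V k = 1) (ρ : densityMatrices n) : densityMatrices n :=
  ⟨∑ k, V k * ρ.1 * (V k)ᴴ, Matrix.posSemidef_sum _ fun k _ =>
    ρ.2.1.mul_mul_conjTranspose_same (V k), by
      rw [Matrix.trace_sum, Finset.sum_congr rfl fun k _ => Matrix.trace_mul_cycle (V k) ρ.1 _,
        ← Matrix.trace_sum, ← Finset.sum_mul, hV, one_mul, ρ.2.2]⟩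

theorem krausMap_mem {κ : Type*} [Fintype κ] (V : κ → Matrix n n ℂ)
    (hV : ∑ k, (V k)ᴴ * V k = 1) : krausMap V hV ∈ quantumTransformations n := by
  refine ⟨krausCP V, fun X => ?_, fun ρ => rfl⟩
  change (∑ k, V k * X * (V k)ᴴ).trace = X.trace
  rw [Matrix.trace_sum, Finset.sum_congr rfl fun k _ => Matrix.trace_mul_cycle (V k) X _,
    ← Matrix.trace_sum, ← Finset.sum_mul, hV, one_mul]

theorem isAffineClass_quantumTransformations :
    IsAffineClass (quantumTransformations n) := by
  rintro Φ ⟨T, -, hT⟩ x y z t - - hz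
  have hs : ∀ (c : ℝ) (X : Matrix n n ℂ), T (c • X) = c • T X := fun c X => by
    rw [← Complex.coe_smul, map_smul, Complex.coe_smul]
  rw [hT, hT, hT, hz, map_add, hs, hs]

/-- The transformation given by a unitary matrix. -/
noncomputable def unitaryMap (U : Matrix.unitaryGroup n ℂ) : densityMatrices n → densityMatrices n :=
  krausMap (fun _ : Unit => U.1) (by
    simpa [Matrix.star_eq_conjTranspose] using Matrix.UnitaryGroup.star_mul_self U)

theorem unitaryMap_mem (U : Matrix.unitaryGroup n ℂ) :
    unitaryMap U ∈ quantumTransformations n := krausMap_mem _ _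

theorem unitaryMap_coe (U : Matrix.unitaryGroup n ℂ) (ρ : densityMatrices n) :
    (unitaryMap U ρ).1 = U.1 * ρ.1 * U.1ᴴ := by
  simp [unitaryMap, krausMap]

theorem unitaryMap_mul (U V : Matrix.unitaryGroup n ℂ) (ρ : densityMatrices n) :
    unitaryMap (U * V) ρ = unitaryMap U (unitaryMap V ρ) := by
  apply Subtype.ext
  simp [unitaryMap_coe, Matrix.mul_assoc]

theorem unitaryMap_one (ρ : densityMatrices n) : unitaryMap 1 ρ = ρ := by
  apply Subtype.ext
  simp [unitaryMap_coe]

/-- The diagonal density matrix with given diagonal. -/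
noncomputable def diagState (p : stdSimplex ℝ n) : densityMatrices n :=
  ⟨Matrix.diagonal fun i => (p.1 i : ℂ), Matrix.PosSemidef.diagonal fun i => by
    simpa using p.2.1 i, by
      rw [Matrix.trace_diagonal, ← Complex.ofReal_sum, p.2.2, Complex.ofReal_one]⟩

/-- The Kraus operators are √(T a b) times the matrix units; they measure in the coordinate basis
and then apply the stochastic matrix. A recovery map lifts in the same way, so quantum covariance
restricts to classical covariance. -/
theorem exists_quantum_of_classical {Φ : stdSimplex ℝ n → stdSimplex ℝ n}
    (hΦ : Φ ∈ classicalTransformations n) :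
    ∃ Φ' ∈ quantumTransformations n, ∀ p, Φ' (diagState p) = diagState (Φ p) := by
  obtain ⟨T, hT, hΦ⟩ := hΦ
  have hΦ : ∀ p, (Φ p).1 = T.mulVec p.1 := hΦ
  rw [Matrix.mem_colStochastic_iff_sum] at hT
  let V : n × n → Matrix n n ℂ := fun x => Matrix.single x.1 x.2 ((√(T x.1 x.2) : ℝ) : ℂ)
  have hsq : ∀ a b, ((√(T a b) : ℝ) : ℂ) * ((√(T a b) : ℝ) : ℂ) = T a b := fun a b => by
    rw [← Complex.ofReal_mul, Real.mul_self_sqrt (hT.1 a b)]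
  have hV : ∑ k, (V k)ᴴ * V k = 1 := by
    have : ∀ k : n × n, (V k)ᴴ * V k = Matrix.single k.2 k.2 (T k.1 k.2 : ℂ) := fun k => by
      simp only [V, Matrix.conjTranspose_single, Matrix.single_mul_single_same]
      rw [Complex.star_def, Complex.conj_ofReal, hsq]
    simp_rw [this]
    rw [Fintype.sum_prod_type_right]
    ext i j
    simp only [Matrix.sum_apply, Matrix.single_apply, Matrix.one_apply]
    by_cases hij : i = j
    · subst hij
      have h1 := congrArg (fun r : ℝ => (r : ℂ)) (hT.2 i)
      simp only [Complex.ofReal_sum, Complex.ofReal_one] at h1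
      rw [Finset.sum_eq_single i (fun b _ hb => by simp [hb]) (by simp)]
      simpa using h1
    · rw [if_neg hij]
      refine Finset.sum_eq_zero fun b _ => Finset.sum_eq_zero fun a _ => if_neg ?_
      rintro ⟨rfl, rfl⟩; exact hij rfl
  refine ⟨krausMap V hV, krausMap_mem V hV, fun p => Subtype.ext ?_⟩
  have : ∀ k : n × n, V k * (diagState p).1 * (V k)ᴴ =
      Matrix.single k.1 k.1 ((T k.1 k.2 * p.1 k.2 : ℝ) : ℂ) := fun k => by
    simp only [V, Matrix.conjTranspose_single, Matrix.single_mul_mul_single, diagState]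
    rw [Complex.star_def, Complex.conj_ofReal, Matrix.diagonal_apply_eq, mul_right_comm, hsq,
      Complex.ofReal_mul]
  simp only [krausMap, this]
  rw [Fintype.sum_prod_type]
  simp only [diagState, hΦ, Matrix.mulVec, dotProduct]
  ext i j
  simp only [Matrix.sum_apply, Matrix.single_apply, Matrix.diagonal_apply]
  by_cases hij : i = j
  · subst hij
    rw [Finset.sum_eq_single i (fun b _ hb => by simp [hb]) (by simp)]
    simp
  · rw [if_neg hij]
    refine Finset.sum_eq_zero fun b _ => Finset.sum_eq_zero fun a _ => if_neg ?_
    rintro ⟨rfl, rfl⟩; exact hij rfl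

theorem diagState_affine (p q r : stdSimplex ℝ n) (t : ℝ)
    (h : r.1 = (1 - t) • p.1 + t • q.1) :
    (diagState r).1 = (1 - t) • (diagState p).1 + t • (diagState q).1 := by
  ext i j
  simp only [diagState, h, Matrix.diagonal_apply, Matrix.add_apply, Matrix.smul_apply]
  split_ifs <;> simp

/-- The linear map from vectors to diagonal matrices. -/
noncomputable def diagMap : (n → ℝ) →ₗ[ℝ] Matrix n n ℂ where
  toFun x := Matrix.diagonal fun i => (x i : ℂ)
  map_add' x y := by ext i j; simp only [Matrix.diagonal_apply, Matrix.add_apply]; split_ifs <;> simp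
  map_smul' c x := by ext i j; simp [Matrix.diagonal_apply]

theorem IsCovariant.comp_diagMap {f : Matrix n n ℂ → ℝ}
    (hf : IsCovariant (quantumTransformations n) f) :
    IsCovariant (classicalTransformations n) fun x => f (diagMap x) := by
  intro Φ hΦ Ψ hΨ x y z hx hy t h0 h1 hz
  obtain ⟨Φ', hΦ', e⟩ := exists_quantum_of_classical hΦ
  obtain ⟨Ψ', hΨ', e'⟩ := exists_quantum_of_classical hΨ
  have := hf Φ' hΦ' Ψ' hΨ' (diagState x) (diagState y) (diagState z) (by rw [e, e', hx])
    (by rw [e, e', hy]) t h0 h1 (diagState_affine x y z t hz)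
  rw [e, e, e] at this
  exact this

end Quantum

end Regret

/-! ### Unitarily affine functions, signs and pinching. -/

namespace Regret

section Quantum

open scoped ComplexOrder Matrix

variable {n : Type*} [Fintype n] [DecidableEq n]

/-- A function on density matrices is unitarily affine if it changes by an affine function under
every change of basis. -/
def IsUnitarilyAffine (k : densityMatrices n → ℝ) : Prop :=
  ∀ U : Matrix.unitaryGroup n ℂ, ∃ ℓ : Matrix n n ℂ →ₗ[ℝ] ℝ, ∀ ρ, k (unitaryMap U ρ) - k ρ = ℓ ρ.1

/-- The monomial unitary matrix with phases `d` and permutation `τ`. -/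
def monomialUnitary (d : n → ℂ) (hd : ∀ a, d a * star (d a) = 1) (τ : Equiv.Perm n) :
    Matrix.unitaryGroup n ℂ :=
  ⟨Matrix.of fun a b => if b = τ a then d a else 0, by
    rw [Matrix.mem_unitaryGroup_iff]
    ext a b
    rw [Matrix.mul_apply, Matrix.one_apply]
    by_cases hab : a = b
    · subst hab
      simp [← hd a]
    · simp [hab]⟩

theorem unitaryMap_monomialUnitary_apply (d : n → ℂ) (hd : ∀ a, d a * star (d a) = 1)
    (τ : Equiv.Perm n) (ρ : densityMatrices n) (a b : n) :
    (unitaryMap (monomialUnitary d hd τ) ρ).1 a b = d a * star (d b) * ρ.1 (τ a) (τ b) := by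
  rw [unitaryMap_coe, Matrix.mul_apply]
  simp only [Matrix.mul_apply, monomialUnitary, Matrix.conjTranspose_apply, Matrix.of_apply]
  rw [Finset.sum_eq_single (τ b)]
  · simp
    ring
  · intro x _ hx
    simp [hx]
  · simp

theorem sign_mul_star {n : Type*} (s : n → ℤˣ) (a : n) : ((s a : ℤ) : ℂ) * star ((s a : ℤ) : ℂ) = 1 := by
  rcases Int.units_eq_one_or (s a) with h | h <;> simp [h]

/-- The diagonal unitary matrix with diagonal entries `±1`. -/
def signUnitary (s : n → ℤˣ) : Matrix.unitaryGroup n ℂ :=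
  monomialUnitary (fun a => ((s a : ℤ) : ℂ)) (sign_mul_star s) 1

theorem unitaryMap_signUnitary_apply (s : n → ℤˣ) (ρ : densityMatrices n) (a b : n) :
    (unitaryMap (signUnitary s) ρ).1 a b = ((s a : ℤ) : ℂ) * ((s b : ℤ) : ℂ) * ρ.1 a b := by
  rw [signUnitary, unitaryMap_monomialUnitary_apply]
  simp

theorem unitaryMap_signUnitary_mul (s t : n → ℤˣ) (ρ : densityMatrices n) :
    unitaryMap (signUnitary s) (unitaryMap (signUnitary t) ρ) =
      unitaryMap (signUnitary (s * t)) ρ := by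
  apply Subtype.ext
  ext a b
  simp only [unitaryMap_signUnitary_apply, Pi.mul_apply, Units.val_mul, Int.cast_mul]
  ring

theorem sum_sign_mul_sign (a b : n) :
    ∑ s : n → ℤˣ, ((s a : ℤ) : ℂ) * ((s b : ℤ) : ℂ) =
      if a = b then (Fintype.card (n → ℤˣ) : ℂ) else 0 := by
  split_ifs with h
  · subst h
    have : ∀ s : n → ℤˣ, ((s a : ℤ) : ℂ) * ((s a : ℤ) : ℂ) = 1 := fun s => by
      simpa using sign_mul_star s a
    simp [this]
  -- Flipping the sign at `a` alone permutes the sum and negates each term.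
  · have e := Fintype.sum_equiv (Equiv.mulLeft (Pi.mulSingle a (-1) : n → ℤˣ))
      (fun s => -(((s a : ℤ) : ℂ) * ((s b : ℤ) : ℂ))) (fun s => ((s a : ℤ) : ℂ) * ((s b : ℤ) : ℂ))
      (fun s => by simp [Ne.symm h])
    rw [Finset.sum_neg_distrib] at e
    exact self_eq_neg.1 e.symm

/-- The pinching that removes the entries of a density matrix in which the labels differ. -/
noncomputable def pinchState (κ : n → n) (ρ : densityMatrices n) : densityMatrices n :=
  ⟨∑ s : n → ℤˣ, (Fintype.card (n → ℤˣ) : ℝ)⁻¹ • (unitaryMap (signUnitary (s ∘ κ)) ρ).1,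
    convex_densityMatrices.sum_mem (fun _ _ => by positivity) (by simp) fun s _ =>
      (unitaryMap (signUnitary (s ∘ κ)) ρ).2⟩

theorem pinchState_apply (κ : n → n) (ρ : densityMatrices n) (a b : n) :
    (pinchState κ ρ).1 a b = if κ a = κ b then ρ.1 a b else 0 := by
  simp only [pinchState, Matrix.sum_apply, Matrix.smul_apply, unitaryMap_signUnitary_apply,
    Function.comp_apply]
  rw [← Finset.smul_sum, ← Finset.sum_mul, sum_sign_mul_sign]
  split_ifs
  · have : (Fintype.card (n → ℤˣ) : ℂ) ≠ 0 := by exact_mod_cast Fintype.card_ne_zero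
    rw [← Complex.coe_smul, smul_eq_mul]
    push_cast
    rw [inv_mul_cancel_left₀]
    simp
  · simp

theorem unitaryMap_pinchState {U : Matrix.unitaryGroup n ℂ} {κ : n → n}
    (h : ∀ s ρ, unitaryMap U (unitaryMap (signUnitary (s ∘ κ)) ρ) =
      unitaryMap (signUnitary (s ∘ κ)) (unitaryMap U ρ)) (ρ : densityMatrices n) :
    unitaryMap U (pinchState κ ρ) = pinchState κ (unitaryMap U ρ) := by
  apply Subtype.ext
  rw [unitaryMap_coe]
  simp only [pinchState, Finset.mul_sum, Finset.sum_mul]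
  refine Finset.sum_congr rfl fun s _ => ?_
  rw [← h, unitaryMap_coe U]
  simp

/-- The change of `k` under `U` is linear in the state. It is constant on the orbit of ρ under the
given signs, because `U` turns them into signs again; and the pinching is the average over that
orbit. -/
theorem IsUnitarilyAffine.sub_eq_pinch {k : densityMatrices n → ℝ} (hk : IsUnitarilyAffine k)
    (hs : ∀ s ρ, k (unitaryMap (signUnitary s) ρ) = k ρ) {U : Matrix.unitaryGroup n ℂ} {κ : n → n}
    (hU : ∀ s ρ, ∃ s', unitaryMap U (unitaryMap (signUnitary (s ∘ κ)) ρ) =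
      unitaryMap (signUnitary s') (unitaryMap U ρ)) (ρ : densityMatrices n) :
    k (unitaryMap U ρ) - k ρ = k (unitaryMap U (pinchState κ ρ)) - k (pinchState κ ρ) := by
  obtain ⟨ℓ, hℓ⟩ := hk U
  have hinv : ∀ s : n → ℤˣ, ℓ (unitaryMap (signUnitary (s ∘ κ)) ρ).1 = ℓ ρ.1 := fun s => by
    obtain ⟨s', e⟩ := hU s ρ
    rw [← hℓ, ← hℓ, e, hs, hs]
  rw [hℓ, hℓ, pinchState, map_sum]
  simp [hinv]

/-- The diagonal of a density matrix. -/
noncomputable def diagPart (ρ : densityMatrices n) : stdSimplex ℝ n :=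
  ⟨fun i => (ρ.1 i i).re, fun i => (Complex.le_def.1 (ρ.2.1.diag_nonneg (i := i))).1, by
    have := congrArg Complex.re ρ.2.2
    simpa [Matrix.trace] using this⟩

theorem eq_diagState {ρ : densityMatrices n} (h : ∀ a b, a ≠ b → ρ.1 a b = 0) :
    ρ = diagState (diagPart ρ) := by
  apply Subtype.ext
  ext a b
  simp only [diagState, Matrix.diagonal_apply, diagPart]
  split_ifs with hab
  · subst hab
    exact Complex.ext rfl (by simpa using (Complex.le_def.1 (ρ.2.1.diag_nonneg (i := a))).2.symm)
  · exact h a b hab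

theorem linearMap_diagState (ℓ : Matrix n n ℂ →ₗ[ℝ] ℝ) (p : stdSimplex ℝ n) :
    ℓ (diagState p).1 = ∑ i, p.1 i * ℓ (diagState (vertex i)).1 := by
  have h1 : ∀ q : stdSimplex ℝ n, ℓ (diagState q).1 = (ℓ ∘ₗ diagMap) q.1 := fun q => rfl
  have h2 : p.1 = ∑ i, p.1 i • (vertex i).1 := by
    have := congrArg Subtype.val
      (kernelMap_eq_self (col := vertex) (p := p) fun b _ => rfl)
    exact this.symm
  rw [h1]
  conv_lhs => rw [h2]
  simp [h1]

theorem unitaryMap_monomialUnitary_diagState (d : n → ℂ) (hd : ∀ a, d a * star (d a) = 1)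
    (τ : Equiv.Perm n) (p : stdSimplex ℝ n) :
    ∃ q, unitaryMap (monomialUnitary d hd τ) (diagState p) = diagState q := by
  refine ⟨_, eq_diagState fun a b hab => ?_⟩
  rw [unitaryMap_monomialUnitary_apply]
  simp [diagState, hab]

/-- Monomial matrices carry signs to signs, so full pinching reduces the change of `k` to diagonal
states, which they permute among themselves and where `k` vanishes. -/
theorem IsUnitarilyAffine.monomial_eq {k : densityMatrices n → ℝ} (hk : IsUnitarilyAffine k)
    (hs : ∀ s ρ, k (unitaryMap (signUnitary s) ρ) = k ρ) (hd0 : ∀ p, k (diagState p) = 0)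
    (d : n → ℂ) (hd : ∀ a, d a * star (d a) = 1) (τ : Equiv.Perm n) (ρ : densityMatrices n) :
    k (unitaryMap (monomialUnitary d hd τ) ρ) = k ρ := by
  have e := hk.sub_eq_pinch hs (U := monomialUnitary d hd τ) (κ := id) (fun s ρ => ⟨s ∘ τ, by
    apply Subtype.ext
    ext a b
    simp only [unitaryMap_monomialUnitary_apply, unitaryMap_signUnitary_apply, Function.comp_apply,
      id]
    ring⟩) ρ
  have hp : pinchState id ρ = diagState (diagPart (pinchState id ρ)) :=
    eq_diagState fun a b hab => by rw [pinchState_apply, if_neg (by simpa using hab)]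
  obtain ⟨q, hq⟩ := unitaryMap_monomialUnitary_diagState d hd τ (diagPart (pinchState id ρ))
  rw [hp, hq, hd0, hd0] at e
  linarith

theorem exists_phase (z : ℂ) : ∃ ζ : ℂ, ζ * star ζ = 1 ∧ ζ * star z = -z := by
  by_cases hz : z = 0
  · exact ⟨1, by simp, by simp [hz]⟩
  · have hz' : star z ≠ 0 := by simpa using hz
    refine ⟨-z / star z, ?_, by field_simp⟩
    rw [star_div₀, star_neg, star_star]
    field_simp

/-- Complementary states on a coordinate plane. -/
theorem IsUnitarilyAffine.eq_of_add_eq {k : densityMatrices n → ℝ} (hk : IsUnitarilyAffine k)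
    (hs : ∀ s ρ, k (unitaryMap (signUnitary s) ρ) = k ρ) (hd0 : ∀ p, k (diagState p) = 0)
    {i j : n} (hij : i ≠ j) (σ σ' : densityMatrices n)
    (hσ : ∀ a b, (a ≠ i ∧ a ≠ j) ∨ (b ≠ i ∧ b ≠ j) → σ.1 a b = 0)
    (hadd : σ.1 + σ'.1 = (diagState (vertex i)).1 + (diagState (vertex j)).1) : k σ = k σ' := by
  obtain ⟨ζ, hζ, hz⟩ := exists_phase (σ.1 i j)
  have hval : ∀ a b, σ.1 a b + σ'.1 a b = Matrix.diagonal
      (fun a => (((vertex i).1 a + (vertex j).1 a : ℝ) : ℂ)) a b := fun a b => by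
    have := congrFun (congrFun hadd a) b
    rw [Matrix.add_apply, Matrix.add_apply] at this
    rw [this]
    simp only [diagState, Matrix.diagonal_apply]
    split_ifs <;> simp
  have htr : σ.1 i i + σ.1 j j = 1 := by
    rw [← σ.2.2, Matrix.trace, Fintype.sum_eq_add i j hij]
    · rfl
    · intro a ha; exact hσ a a (Or.inl ha)
  have hherm : ∀ a b, star (σ.1 a b) = σ.1 b a := fun a b => σ.2.1.1.apply b a
  have hd : ∀ a, (if a = i then ζ else 1) * star (if a = i then ζ else 1) = 1 := fun a => by
    split_ifs
    · exact hζ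
    · simp
  -- In the plane of `i` and `j`, the complement of a state swaps the diagonal entries and negates
  -- the off-diagonal one. The transposition conjugates that entry; the phase `ζ` turns its
  -- conjugate into its negative.
  rw [← hk.monomial_eq hs hd0 (fun a => if a = i then ζ else 1) hd (Equiv.swap i j) σ]
  congr 1
  apply Subtype.ext
  ext a b
  rw [unitaryMap_monomialUnitary_apply, eq_sub_of_add_eq' (hval a b)]
  simp only [vertex, Matrix.diagonal_apply, Pi.single_apply]
  have hz' : star ζ * σ.1 i j = -σ.1 j i := by
    rw [← hherm i j, ← star_neg, ← hz, star_mul, star_star, mul_comm]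
  rw [hherm] at hz
  by_cases hai : a = i
  · subst hai
    by_cases hba : b = a
    · subst hba
      simp only [Equiv.swap_apply_left, if_true, hζ, if_neg hij]
      push_cast
      linear_combination htr
    by_cases hbj : b = j
    · subst hbj
      simp only [Equiv.swap_apply_left, Equiv.swap_apply_right, if_true, if_neg hij.symm, if_neg hij]
      simp [hz]
    · rw [Equiv.swap_apply_of_ne_of_ne hba hbj, hσ _ b (Or.inr ⟨hba, hbj⟩),
        hσ a b (Or.inr ⟨hba, hbj⟩)]
      simp [Ne.symm hba]
  by_cases haj : a = j
  · subst haj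
    by_cases hbi : b = i
    · subst hbi
      simp only [Equiv.swap_apply_left, Equiv.swap_apply_right, if_true, if_neg hij.symm]
      simpa using hz'
    by_cases hba : b = a
    · subst hba
      simp only [Equiv.swap_apply_right, if_true, if_neg hai]
      simp
      linear_combination htr
    · rw [Equiv.swap_apply_of_ne_of_ne hbi hba, hσ _ b (Or.inr ⟨hbi, hba⟩),
        hσ a b (Or.inr ⟨hbi, hba⟩)]
      simp [Ne.symm hba]
  · rw [Equiv.swap_apply_of_ne_of_ne hai haj, hσ a _ (Or.inl ⟨hai, haj⟩),
        hσ a _ (Or.inl ⟨hai, haj⟩)]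
    simp [hai, haj]

end Quantum

end Regret

/-! ### Reflections in coordinate planes, and vanishing on pure states. -/

namespace Regret

section Quantum

open scoped ComplexOrder Matrix

variable {n : Type*} [Fintype n] [DecidableEq n]

theorem star_dotProduct_self {n : Type*} [Fintype n] (w : n → ℂ) :
    star (star w ⬝ᵥ w) = star w ⬝ᵥ w := by
  simp [dotProduct, mul_comm]

/-- The reflection in the hyperplane orthogonal to `w`. -/
noncomputable def householder (w : n → ℂ) : Matrix.unitaryGroup n ℂ :=
  ⟨1 - (2 / (star w ⬝ᵥ w)) • Matrix.vecMulVec w (star w), by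
    have hstar : star (star w ⬝ᵥ w) = star w ⬝ᵥ w := star_dotProduct_self w
    rw [Matrix.mem_unitaryGroup_iff, Matrix.star_eq_conjTranspose, Matrix.conjTranspose_sub,
      Matrix.conjTranspose_smul, Matrix.conjTranspose_vecMulVec, star_star, Matrix.conjTranspose_one,
      star_div₀, hstar, sub_mul, mul_sub, mul_sub, one_mul, mul_one, one_mul, smul_mul_smul_comm,
      Matrix.vecMulVec_mul_vecMulVec, Matrix.vecMulVec_smul, smul_smul]
    by_cases h : star w ⬝ᵥ w = 0
    · simp [h]
    · rw [show star (2 : ℂ) = 2 by simp]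
      have : 2 / (star w ⬝ᵥ w) * (2 / (star w ⬝ᵥ w)) * (star w ⬝ᵥ w) =
        2 / (star w ⬝ᵥ w) + 2 / (star w ⬝ᵥ w) := by field_simp; ring
      rw [this, add_smul]
      abel⟩

theorem householder_mulVec (w v : n → ℂ) :
    (householder w).1 *ᵥ v = v - (2 / (star w ⬝ᵥ w) * (star w ⬝ᵥ v)) • w := by
  simp only [householder, Matrix.sub_mulVec, Matrix.one_mulVec, Matrix.smul_mulVec,
    Matrix.vecMulVec_mulVec, smul_smul, op_smul_eq_smul]

theorem householder_mul_diagonal {w : n → ℂ} {i j : n} (hw : ∀ a, a ≠ i → a ≠ j → w a = 0)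
    {x : n → ℂ} (hx : x i = x j) :
    (householder w).1 * Matrix.diagonal x = Matrix.diagonal x * (householder w).1 := by
  have key : Matrix.vecMulVec w (star w) * Matrix.diagonal x =
      Matrix.diagonal x * Matrix.vecMulVec w (star w) := by
    ext a b
    rw [Matrix.mul_diagonal, Matrix.diagonal_mul, Matrix.vecMulVec_apply, Pi.star_apply]
    by_cases ha : a = i ∨ a = j
    · by_cases hb : b = i ∨ b = j
      · have : x a = x b := by
          rcases ha with rfl | rfl <;> rcases hb with rfl | rfl <;> simp [hx]
        rw [this]; ring
      · push Not at hb
        simp [hw b hb.1 hb.2]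
    · push Not at ha
      simp [hw a ha.1 ha.2]
  simp only [householder, sub_mul, mul_sub, one_mul, mul_one, Matrix.smul_mul, Matrix.mul_smul, key]

theorem householder_mul_self (w : n → ℂ) : householder w * householder w = 1 := by
  have h : star (householder w) = householder w := by
    apply Subtype.ext
    have hstar : star (star w ⬝ᵥ w) = star w ⬝ᵥ w := star_dotProduct_self w
    change star (householder w).1 = (householder w).1
    simp only [householder]
    rw [Matrix.star_eq_conjTranspose, Matrix.conjTranspose_sub,
      Matrix.conjTranspose_smul, Matrix.conjTranspose_vecMulVec, star_star, Matrix.conjTranspose_one,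
      star_div₀, hstar, show star (2 : ℂ) = 2 by simp]
  nth_rewrite 1 [← h]
  exact Unitary.star_mul_self _

theorem unitaryMap_comm {U V : Matrix.unitaryGroup n ℂ} (h : U.1 * V.1 = V.1 * U.1)
    (ρ : densityMatrices n) :
    unitaryMap U (unitaryMap V ρ) = unitaryMap V (unitaryMap U ρ) := by
  rw [← unitaryMap_mul, ← unitaryMap_mul, show U * V = V * U from Subtype.ext h]

theorem signUnitary_coe (s : n → ℤˣ) :
    (signUnitary s).1 = Matrix.diagonal fun a => ((s a : ℤ) : ℂ) := by
  ext a b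
  simp [signUnitary, monomialUnitary, Matrix.diagonal_apply, eq_comm]

theorem unitaryMap_vecMulVec (U : Matrix.unitaryGroup n ℂ) {ρ : densityMatrices n} {v : n → ℂ}
    (hρ : ρ.1 = Matrix.vecMulVec v (star v)) :
    (unitaryMap U ρ).1 = Matrix.vecMulVec (U.1 *ᵥ v) (star (U.1 *ᵥ v)) := by
  rw [unitaryMap_coe, hρ, Matrix.mul_vecMulVec, Matrix.vecMulVec_mul, Matrix.star_mulVec]

theorem diagState_vertex (i : n) :
    (diagState (vertex i)).1 = Matrix.vecMulVec (Pi.single i 1) (star (Pi.single i 1 : n → ℂ)) := by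
  ext a b
  simp only [diagState, vertex, Matrix.diagonal_apply, Matrix.vecMulVec_apply, Pi.star_apply,
    Pi.single_apply]
  by_cases ha : a = i <;> by_cases hb : b = i <;> by_cases hab : a = b <;> simp_all

/-- By linearity only vertices matter, and those outside the plane are fixed. The images of the two
vertices in the plane are complementary, so `k` agrees on them; their midpoint is fixed by the
reflection, so the two values sum to 0. -/
theorem IsUnitarilyAffine.householder_diagState {k : densityMatrices n → ℝ}
    (hk : IsUnitarilyAffine k) (hs : ∀ s ρ, k (unitaryMap (signUnitary s) ρ) = k ρ)
    (hd0 : ∀ p, k (diagState p) = 0) {i j : n} (hij : i ≠ j) {w : n → ℂ}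
    (hw : ∀ a, a ≠ i → a ≠ j → w a = 0) (p : stdSimplex ℝ n) :
    k (unitaryMap (householder w) (diagState p)) = 0 := by
  obtain ⟨ℓ, hℓ⟩ := hk (householder w)
  have hℓd : ∀ p, ℓ (diagState p).1 = k (unitaryMap (householder w) (diagState p)) := fun p => by
    rw [← hℓ, hd0, sub_zero]
  rw [← hℓd, linearMap_diagState]
  have hmul : ∀ m, (householder w).1 *ᵥ (Pi.single m 1 : n → ℂ) =
      Pi.single m 1 - (2 / (star w ⬝ᵥ w) * star (w m)) • w := fun m => by
    rw [householder_mulVec, dotProduct_single, mul_one, Pi.star_apply]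
  have hother : ∀ m, m ≠ i → m ≠ j → ℓ (diagState (vertex m)).1 = 0 := fun m hmi hmj => by
    have : unitaryMap (householder w) (diagState (vertex m)) = diagState (vertex m) := by
      apply Subtype.ext
      rw [unitaryMap_vecMulVec _ (diagState_vertex m), hmul, hw m hmi hmj, diagState_vertex]
      simp
    rw [hℓd, this, hd0]
  have hconj : (householder w).1 * (Matrix.diagonal fun a => (((vertex i).1 a + (vertex j).1 a : ℝ) : ℂ)) *
      (householder w).1ᴴ = Matrix.diagonal fun a => (((vertex i).1 a + (vertex j).1 a : ℝ) : ℂ) := by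
    rw [householder_mul_diagonal hw (by simp [vertex, hij, hij.symm]), Matrix.mul_assoc,
      ← Matrix.star_eq_conjTranspose, Matrix.mem_unitaryGroup_iff.1 (householder w).2, mul_one]
  have hsumd : (diagState (vertex i)).1 + (diagState (vertex j)).1 =
      Matrix.diagonal fun a => (((vertex i).1 a + (vertex j).1 a : ℝ) : ℂ) := by
    simp [diagState, Matrix.diagonal_add]
  have heq : k (unitaryMap (householder w) (diagState (vertex i))) =
      k (unitaryMap (householder w) (diagState (vertex j))) := by
    refine hk.eq_of_add_eq hs hd0 hij _ _ (fun a b hab => ?_) ?_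
    · rw [unitaryMap_vecMulVec _ (diagState_vertex i), hmul, Matrix.vecMulVec_apply]
      rcases hab with h | h
      · simp [hw a h.1 h.2, h.1]
      · simp [hw b h.1 h.2, h.1]
    · rw [unitaryMap_coe, unitaryMap_coe, ← add_mul, ← mul_add, hsumd, hconj]
  let q : stdSimplex ℝ n := ⟨(1 / 2 : ℝ) • (vertex i).1 + (1 / 2 : ℝ) • (vertex j).1,
    convex_stdSimplex ℝ n (vertex i).2 (vertex j).2 (by norm_num) (by norm_num) (by norm_num)⟩
  have hq : (diagState q).1 = (1 / 2 : ℝ) • ((diagState (vertex i)).1 + (diagState (vertex j)).1) := by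
    rw [diagState_affine (vertex i) (vertex j) q (1 / 2) (by simp only [q]; norm_num), smul_add]
    norm_num
  have hqfix : unitaryMap (householder w) (diagState q) = diagState q := by
    apply Subtype.ext
    rw [unitaryMap_coe, hq, Matrix.mul_smul, Matrix.smul_mul, hsumd, hconj]
  have hmid : ℓ (diagState q).1 = 0 := by rw [hℓd, hqfix, hd0]
  rw [hq, map_smul, map_add, hℓd, hℓd, ← heq, smul_eq_mul] at hmid
  have hi : k (unitaryMap (householder w) (diagState (vertex i))) = 0 := by linarith
  refine Finset.sum_eq_zero fun m _ => ?_
  by_cases hmi : m = i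
  · rw [hmi, hℓd, hi, mul_zero]
  by_cases hmj : m = j
  · rw [hmj, hℓd, ← heq, hi, mul_zero]
  rw [hother m hmi hmj, mul_zero]

/-- A reflection in a coordinate plane that annihilates a coordinate of a given vector. -/
theorem exists_householder_mulVec (v : n → ℂ) {i j : n} (hij : i ≠ j) (hi : v i ≠ 0)
    (hj : v j ≠ 0) : ∃ w : n → ℂ, (∀ a, a ≠ i → a ≠ j → w a = 0) ∧
      ((householder w).1 *ᵥ v) j = 0 ∧
      ∀ a, a ≠ i → a ≠ j → ((householder w).1 *ᵥ v) a = v a := by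
  set c := ‖v i‖ with hc
  set d := ‖v j‖ with hd
  have hc0 : 0 < c := norm_pos_iff.2 hi
  have hd0 : 0 < d := norm_pos_iff.2 hj
  set r := √(c ^ 2 + d ^ 2) with hr
  have hr2 : r ^ 2 = c ^ 2 + d ^ 2 := Real.sq_sqrt (by positivity)
  -- The reflection should send `v` to the vector with `i`-entry `(r / c) * v i` and `j`-entry 0:
  -- same norm, same phase at `i`. The mirror vector `w` is `v` minus that target, whose `i`-entry
  -- is `α * v i`.
  set α : ℝ := 1 - r / c with hα
  have hαc : α * c = c - r := by rw [hα]; field_simp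
  let w : n → ℂ := fun a => if a = i then α * v i else if a = j then v j else 0
  have wi : w i = α * v i := by simp [w]
  have wj : w j = v j := by simp [w, hij.symm]
  have wo : ∀ a, a ≠ i → a ≠ j → w a = 0 := fun a ha hb => by simp [w, ha, hb]
  have hci : star (v i) * v i = ((c ^ 2 : ℝ) : ℂ) := by
    rw [mul_comm, Complex.star_def, Complex.mul_conj, Complex.normSq_eq_norm_sq]
  have hcj : star (v j) * v j = ((d ^ 2 : ℝ) : ℂ) := by
    rw [mul_comm, Complex.star_def, Complex.mul_conj, Complex.normSq_eq_norm_sq]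
  have hN : star w ⬝ᵥ w = ((α ^ 2 * c ^ 2 + d ^ 2 : ℝ) : ℂ) := by
    rw [dotProduct, Fintype.sum_eq_add i j hij fun a ha => by rw [wo a ha.1 ha.2, mul_zero]]
    simp only [Pi.star_apply, wi, wj, star_mul, hcj]
    rw [Complex.star_def, Complex.conj_ofReal, ← Complex.star_def]
    push_cast at hci ⊢
    linear_combination (α : ℂ) ^ 2 * hci
  have hV : star w ⬝ᵥ v = ((α * c ^ 2 + d ^ 2 : ℝ) : ℂ) := by
    rw [dotProduct, Fintype.sum_eq_add i j hij fun a ha => by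
      rw [Pi.star_apply, wo a ha.1 ha.2, star_zero, zero_mul]]
    simp only [Pi.star_apply, wi, wj, star_mul, hcj]
    rw [Complex.star_def, Complex.conj_ofReal, ← Complex.star_def]
    push_cast at hci ⊢
    linear_combination (α : ℂ) * hci
  have hNV : α ^ 2 * c ^ 2 + d ^ 2 = 2 * (α * c ^ 2 + d ^ 2) := by
    have h1 : α ^ 2 * c ^ 2 = (c - r) ^ 2 := by rw [← hαc]; ring
    have h2 : α * c ^ 2 = c * (c - r) := by rw [← hαc]; ring
    rw [h1, h2]; linarith
  have hpos : α * c ^ 2 + d ^ 2 ≠ 0 := fun h => by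
    rw [h, mul_zero] at hNV
    have : 0 < d ^ 2 := by positivity
    have : 0 ≤ α ^ 2 * c ^ 2 := by positivity
    linarith
  have hHv : (householder w).1 *ᵥ v = v - w := by
    rw [householder_mulVec, hN, hV, hNV]
    have : (2 : ℂ) / ((2 * (α * c ^ 2 + d ^ 2) : ℝ) : ℂ) * ((α * c ^ 2 + d ^ 2 : ℝ) : ℂ) = 1 := by
      have h : ((α * c ^ 2 + d ^ 2 : ℝ) : ℂ) ≠ 0 := by exact_mod_cast hpos
      rw [Complex.ofReal_mul]
      push_cast at h ⊢
      field_simp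
    rw [this, one_smul]
  refine ⟨w, wo, ?_, fun a ha hb => ?_⟩
  · rw [hHv, Pi.sub_apply, wj, sub_self]
  · rw [hHv, Pi.sub_apply, wo a ha hb, sub_zero]

/-- Induction on the number of nonzero coordinates: a plane reflection kills one of them, and
pinching shows that `k` does not change under it. -/
theorem IsUnitarilyAffine.eq_zero_of_vecMulVec {k : densityMatrices n → ℝ}
    (hk : IsUnitarilyAffine k) (hs : ∀ s ρ, k (unitaryMap (signUnitary s) ρ) = k ρ)
    (hd0 : ∀ p, k (diagState p) = 0) (m : ℕ) : ∀ v : n → ℂ,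
      (Finset.univ.filter fun a => v a ≠ 0).card = m → ∀ ρ : densityMatrices n,
        ρ.1 = Matrix.vecMulVec v (star v) → k ρ = 0 := by
  induction m using Nat.strong_induction_on with
  | _ m ih =>
  intro v hv ρ hρ
  by_cases hex : ∃ i j, i ≠ j ∧ v i ≠ 0 ∧ v j ≠ 0
  · obtain ⟨i, j, hij, hi, hj⟩ := hex
    obtain ⟨w, hw, hvj, hvo⟩ := exists_householder_mulVec v hij hi hj
    set H := householder w with hH
    have hρ' := unitaryMap_vecMulVec H hρ
    have h1 : k (unitaryMap H ρ) = 0 := by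
      refine ih _ ?_ (H.1 *ᵥ v) rfl _ hρ'
      rw [← hv]
      refine Finset.card_lt_card (Finset.ssubset_iff_of_subset ?_ |>.2 ⟨j, by simpa using hj,
        by simpa using hvj⟩)
      intro a ha
      simp only [Finset.mem_filter, Finset.mem_univ, true_and] at ha ⊢
      by_cases hai : a = i
      · rwa [hai]
      by_cases haj : a = j
      · rwa [haj]
      rwa [← hvo a hai haj]
    -- Giving `i` and `j` one label keeps the 2×2 block on which the reflection acts, so pinching
    -- commutes with it. The reflected vector has no `j`-entry, so the pinched reflected state is
    -- diagonal.
    let κ : n → n := fun a => if a = j then i else a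
    have hcomm : ∀ s ρ, unitaryMap H (unitaryMap (signUnitary (s ∘ κ)) ρ) =
        unitaryMap (signUnitary (s ∘ κ)) (unitaryMap H ρ) := fun s ρ =>
      unitaryMap_comm (by
        rw [signUnitary_coe]
        exact householder_mul_diagonal hw (by simp [κ])) ρ
    have h2 := hk.sub_eq_pinch hs (fun s ρ => ⟨_, hcomm s ρ⟩) ρ
    have h3 : unitaryMap H (pinchState κ ρ) = diagState (diagPart (unitaryMap H (pinchState κ ρ))) := by
      refine eq_diagState fun a b hab => ?_
      rw [unitaryMap_pinchState hcomm, pinchState_apply]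
      split_ifs with hκ
      · rw [hρ', Matrix.vecMulVec_apply, Pi.star_apply]
        by_cases haj : a = j
        · rw [haj, hvj, zero_mul]
        by_cases hbj : b = j
        · rw [hbj, hvj, star_zero, mul_zero]
        simp only [κ, if_neg haj, if_neg hbj] at hκ
        exact absurd hκ hab
      · rfl
    have h4 : pinchState κ ρ =
        unitaryMap H (diagState (diagPart (unitaryMap H (pinchState κ ρ)))) := by
      rw [← h3, ← unitaryMap_mul, householder_mul_self, unitaryMap_one]
    have h5 : k (pinchState κ ρ) = 0 := by
      rw [h4]; exact hk.householder_diagState hs hd0 hij hw _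
    rw [h1, h5, h3, hd0] at h2
    linarith
  · push Not at hex
    rw [eq_diagState (ρ := ρ) fun a b hab => ?_, hd0]
    rw [hρ, Matrix.vecMulVec_apply, Pi.star_apply]
    by_cases ha : v a = 0
    · rw [ha, zero_mul]
    · rw [hex a b hab ha, star_zero, mul_zero]

theorem exists_eq_unitaryMap_diagState (ρ : densityMatrices n) :
    ∃ U p, ρ = unitaryMap U (diagState p) := by
  have hA := ρ.2.1.1
  refine ⟨hA.eigenvectorUnitary, ⟨hA.eigenvalues, fun i => ρ.2.1.eigenvalues_nonneg i, ?_⟩, ?_⟩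
  · have := hA.trace_eq_sum_eigenvalues
    rw [ρ.2.2] at this
    have h := congrArg Complex.re this
    simpa using h.symm
  · apply Subtype.ext
    rw [unitaryMap_coe]
    exact hA.spectral_theorem

theorem IsUnitarilyAffine.add_linearMap {k : densityMatrices n → ℝ} (hk : IsUnitarilyAffine k)
    (L : Matrix n n ℂ →ₗ[ℝ] ℝ) : IsUnitarilyAffine fun ρ => k ρ + L ρ.1 := by
  intro U
  obtain ⟨ℓ, hℓ⟩ := hk U
  refine ⟨ℓ + (L ∘ₗ LinearMap.mulRight ℝ U.1ᴴ ∘ₗ LinearMap.mulLeft ℝ U.1 - L), fun ρ => ?_⟩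
  simp only [LinearMap.add_apply, LinearMap.sub_apply, LinearMap.comp_apply,
    LinearMap.mulRight_apply, LinearMap.mulLeft_apply, ← hℓ, unitaryMap_coe]
  ring

/-- A unitarily affine function of density matrices that is affine on the diagonal matrices is
affine. -/
theorem IsUnitarilyAffine.exists_linearMap {k : densityMatrices n → ℝ}
    (hk : IsUnitarilyAffine k)
    (hdiag : ∀ p, k (diagState p) = ∑ i, p.1 i * k (diagState (vertex i))) :
    ∃ L : Matrix n n ℂ →ₗ[ℝ] ℝ, ∀ ρ, k ρ = L ρ.1 := by
  choose ℓ hℓ using fun s : n → ℤˣ => hk (signUnitary s)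
  set N : ℝ := ((Fintype.card (n → ℤˣ) : ℕ) : ℝ) with hN
  have hN0 : N ≠ 0 := by simp [hN]
  -- Adding the average of the increments `ℓ s` replaces `k` by its mean over the sign group, which
  -- is sign invariant. `L₂` below then cancels the values on diagonal states without spoiling
  -- invariance.
  let L₁ : Matrix n n ℂ →ₗ[ℝ] ℝ := ∑ s, N⁻¹ • ℓ s
  let k₁ : densityMatrices n → ℝ := fun ρ => k ρ + L₁ ρ.1
  have hk₁ : IsUnitarilyAffine k₁ := hk.add_linearMap L₁
  have hk₁avg : ∀ ρ, k₁ ρ = N⁻¹ * ∑ s, k (unitaryMap (signUnitary s) ρ) := fun ρ => by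
    have : ∀ s, k (unitaryMap (signUnitary s) ρ) = k ρ + ℓ s ρ.1 := fun s => by
      rw [← hℓ]; ring
    simp only [this, k₁, L₁, Finset.sum_add_distrib, LinearMap.sum_apply, LinearMap.smul_apply,
      smul_eq_mul, ← Finset.mul_sum, mul_add, Finset.sum_const, nsmul_eq_mul, Finset.card_univ]
    rw [← hN, inv_mul_cancel_left₀ hN0]
  have hk₁s : ∀ t ρ, k₁ (unitaryMap (signUnitary t) ρ) = k₁ ρ := fun t ρ => by
    simp only [hk₁avg, unitaryMap_signUnitary_mul]
    congr 1
    exact Fintype.sum_equiv (Equiv.mulRight t) _ _ fun s => rfl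
  have hk₁d : ∀ p, k₁ (diagState p) = ∑ i, p.1 i * k₁ (diagState (vertex i)) := fun p => by
    simp only [k₁, mul_add, Finset.sum_add_distrib]
    rw [hdiag, linearMap_diagState L₁ p]
  let L₂ : Matrix n n ℂ →ₗ[ℝ] ℝ :=
    ∑ i, (-k₁ (diagState (vertex i))) • (Complex.reLm ∘ₗ (Matrix.entryLinearMap ℝ ℂ i i))
  have hL₂ : ∀ X, L₂ X = -∑ i, (X i i).re * k₁ (diagState (vertex i)) := fun X => by
    simp [L₂, mul_comm]
  let k₂ : densityMatrices n → ℝ := fun ρ => k₁ ρ + L₂ ρ.1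
  have hk₂ : IsUnitarilyAffine k₂ := hk₁.add_linearMap L₂
  have hk₂s : ∀ t ρ, k₂ (unitaryMap (signUnitary t) ρ) = k₂ ρ := fun t ρ => by
    have : ∀ i, (unitaryMap (signUnitary t) ρ).1 i i = ρ.1 i i := fun i => by
      rw [unitaryMap_signUnitary_apply]
      rcases Int.units_eq_one_or (t i) with h | h <;> simp [h]
    simp only [k₂, hk₁s, hL₂, this]
  have hk₂d : ∀ p, k₂ (diagState p) = 0 := fun p => by
    simp only [k₂, hL₂]
    rw [hk₁d]
    simp [diagState]
  refine ⟨-(L₁ + L₂), fun ρ => ?_⟩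
  suffices h : k₂ ρ = 0 by
    simp only [k₂, k₁] at h
    simp only [LinearMap.neg_apply, LinearMap.add_apply]
    linarith
  obtain ⟨U, p, rfl⟩ := exists_eq_unitaryMap_diagState ρ
  obtain ⟨ℓ', hℓ'⟩ := hk₂ U
  have h := hℓ' (diagState p)
  rw [hk₂d, sub_zero] at h
  rw [h, linearMap_diagState]
  refine Finset.sum_eq_zero fun i _ => ?_
  rw [← hℓ', hk₂d, sub_zero, hk₂.eq_zero_of_vecMulVec hk₂s hk₂d _ _ rfl _
    (unitaryMap_vecMulVec U (diagState_vertex i)), mul_zero]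

end Quantum

end Regret

/-! ### Entropy by spectral calculus, and Klein's inequality. -/

namespace Regret

section Quantum

open scoped ComplexOrder Matrix

variable {n : Type*} [Fintype n] [DecidableEq n]

theorem cfc_unitary_diagonal (f : ℝ → ℝ) (U : Matrix.unitaryGroup n ℂ) (x : n → ℝ) :
    cfc f (U.1 * Matrix.diagonal (fun i => (x i : ℂ)) * U.1ᴴ) =
      U.1 * Matrix.diagonal (fun i => (f (x i) : ℂ)) * U.1ᴴ := by
  set A := U.1 * Matrix.diagonal (fun i => (x i : ℂ)) * U.1ᴴ with hAdef
  have hA : A.IsHermitian := Matrix.isHermitian_mul_mul_conjTranspose _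
    (Matrix.isHermitian_diagonal_of_self_adjoint _ (funext fun i => by simp))
  rw [hA.cfc_eq, Matrix.IsHermitian.cfc, Unitary.conjStarAlgAut_apply]
  set V := hA.eigenvectorUnitary
  have hspec : A = V.1 * Matrix.diagonal (fun i => (hA.eigenvalues i : ℂ)) * V.1ᴴ :=
    hA.spectral_theorem
  have hU : U.1ᴴ * U.1 = 1 := Matrix.mem_unitaryGroup_iff'.1 U.2
  have hU' : U.1 * U.1ᴴ = 1 := Matrix.mem_unitaryGroup_iff.1 U.2
  have hV : V.1ᴴ * V.1 = 1 := Matrix.mem_unitaryGroup_iff'.1 V.2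
  have hV' : V.1 * V.1ᴴ = 1 := Matrix.mem_unitaryGroup_iff.1 V.2
  have hW : (V.1ᴴ * U.1) * Matrix.diagonal (fun i => (x i : ℂ)) =
      Matrix.diagonal (fun i => (hA.eigenvalues i : ℂ)) * (V.1ᴴ * U.1) := by
    have h1 : V.1ᴴ * A * U.1 = (V.1ᴴ * U.1) * Matrix.diagonal (fun i => (x i : ℂ)) := by
      rw [hAdef, Matrix.mul_assoc, Matrix.mul_assoc (U.1 * _), hU, mul_one, Matrix.mul_assoc]
    have h2 : V.1ᴴ * A * U.1 =
        Matrix.diagonal (fun i => (hA.eigenvalues i : ℂ)) * (V.1ᴴ * U.1) := by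
      conv_lhs => rw [hspec]
      rw [← Matrix.mul_assoc, ← Matrix.mul_assoc, hV, one_mul, Matrix.mul_assoc]
    rw [← h1, h2]
  -- An intertwiner of two diagonal matrices has nonzero entries only where the eigenvalues agree,
  -- so it also intertwines their images under `f`. Hence the calculus does not depend on the
  -- diagonalization.
  have hWf : (V.1ᴴ * U.1) * Matrix.diagonal (fun i => (f (x i) : ℂ)) =
      Matrix.diagonal (fun i => (f (hA.eigenvalues i) : ℂ)) * (V.1ᴴ * U.1) := by
    ext i j
    have h := congrFun (congrFun hW i) j
    rw [Matrix.mul_diagonal, Matrix.diagonal_mul] at h ⊢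
    by_cases h0 : (V.1ᴴ * U.1) i j = 0
    · rw [h0, mul_zero, zero_mul]
    · rw [mul_comm] at h
      have h3 := mul_right_cancel₀ h0 h
      rw [Complex.ofReal_inj] at h3
      rw [h3, mul_comm]
  calc V.1 * Matrix.diagonal (fun i => (f (hA.eigenvalues i) : ℂ)) * V.1ᴴ
      = V.1 * (Matrix.diagonal (fun i => (f (hA.eigenvalues i) : ℂ)) * (V.1ᴴ * U.1)) * U.1ᴴ := by
        simp only [Matrix.mul_assoc, hU', mul_one]
    _ = V.1 * ((V.1ᴴ * U.1) * Matrix.diagonal (fun i => (f (x i) : ℂ))) * U.1ᴴ := by rw [hWf]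
    _ = (V.1 * V.1ᴴ) * U.1 * Matrix.diagonal (fun i => (f (x i) : ℂ)) * U.1ᴴ := by
        simp only [Matrix.mul_assoc]
    _ = U.1 * Matrix.diagonal (fun i => (f (x i) : ℂ)) * U.1ᴴ := by rw [hV', one_mul]

theorem cfc_unitaryMap_diagState (f : ℝ → ℝ) (U : Matrix.unitaryGroup n ℂ) (p : stdSimplex ℝ n) :
    cfc f (unitaryMap U (diagState p)).1 =
      U.1 * Matrix.diagonal (fun i => (f (p.1 i) : ℂ)) * U.1ᴴ := by
  rw [unitaryMap_coe]
  exact cfc_unitary_diagonal f U p.1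

theorem trace_mul_cfc_unitaryMap_diagState (f : ℝ → ℝ) (U : Matrix.unitaryGroup n ℂ)
    (p : stdSimplex ℝ n) (X : Matrix n n ℂ) :
    (X * cfc f (unitaryMap U (diagState p)).1).trace.re =
      ∑ i, ((U.1ᴴ * X * U.1) i i).re * f (p.1 i) := by
  rw [cfc_unitaryMap_diagState, ← Matrix.mul_assoc, ← Matrix.mul_assoc, Matrix.trace_mul_comm,
    ← Matrix.mul_assoc, ← Matrix.mul_assoc, Matrix.trace, Complex.re_sum]
  refine Finset.sum_congr rfl fun i _ => ?_
  rw [Matrix.diag_apply, Matrix.mul_diagonal]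
  simp

/-- Von Neumann entropy as a function of matrices. -/
noncomputable def matrixEntropy (X : Matrix n n ℂ) : ℝ := -(X * cfc Real.log X).trace.re

theorem matrixEntropy_unitaryMap_diagState (U : Matrix.unitaryGroup n ℂ) (p : stdSimplex ℝ n) :
    matrixEntropy (unitaryMap U (diagState p)).1 = ∑ i, Real.negMulLog (p.1 i) := by
  rw [matrixEntropy, trace_mul_cfc_unitaryMap_diagState, ← Finset.sum_neg_distrib]
  refine Finset.sum_congr rfl fun i _ => ?_
  have hU : U.1ᴴ * U.1 = 1 := Matrix.mem_unitaryGroup_iff'.1 U.2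
  have : U.1ᴴ * (unitaryMap U (diagState p)).1 * U.1 = (diagState p).1 := by
    rw [unitaryMap_coe]
    simp only [← Matrix.mul_assoc, hU, one_mul]
    rw [Matrix.mul_assoc, hU, mul_one]
  rw [this]
  simp [diagState, Real.negMulLog]

theorem matrixEntropy_diagState (p : stdSimplex ℝ n) :
    matrixEntropy (diagState p).1 = ∑ i, Real.negMulLog (p.1 i) := by
  rw [← matrixEntropy_unitaryMap_diagState 1 p, unitaryMap_one]

theorem matrixEntropy_unitaryMap (U : Matrix.unitaryGroup n ℂ) (ρ : densityMatrices n) :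
    matrixEntropy (unitaryMap U ρ).1 = matrixEntropy ρ.1 := by
  obtain ⟨V, p, rfl⟩ := exists_eq_unitaryMap_diagState ρ
  rw [← unitaryMap_mul, matrixEntropy_unitaryMap_diagState, matrixEntropy_unitaryMap_diagState]

theorem star_unitaryMap (U : Matrix.unitaryGroup n ℂ) (ρ : densityMatrices n) :
    (unitaryMap (star U) ρ).1 = U.1ᴴ * ρ.1 * U.1 := by
  rw [unitaryMap_coe]
  simp [Matrix.star_eq_conjTranspose]

theorem sum_normSq_row (U : Matrix.unitaryGroup n ℂ) (i : n) : ∑ k, ‖U.1 i k‖ ^ 2 = 1 := by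
  have hU' : U.1 * U.1ᴴ = 1 := Matrix.mem_unitaryGroup_iff.1 U.2
  have h := congrArg Complex.re (congrFun (congrFun hU' i) i)
  rw [Matrix.mul_apply, Matrix.one_apply_eq, Complex.re_sum, Complex.one_re] at h
  rw [← h]
  refine Finset.sum_congr rfl fun k _ => ?_
  rw [Matrix.conjTranspose_apply, Complex.star_def, Complex.mul_conj, Complex.ofReal_re,
    Complex.normSq_eq_norm_sq]

theorem sum_normSq_col (U : Matrix.unitaryGroup n ℂ) (k : n) : ∑ i, ‖U.1 i k‖ ^ 2 = 1 := by
  have h := sum_normSq_row (star U) k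
  simpa using h

theorem unitaryMap_diagState_apply_self (U : Matrix.unitaryGroup n ℂ) (p : stdSimplex ℝ n) (i : n) :
    ((unitaryMap U (diagState p)).1 i i).re = ∑ k, ‖U.1 i k‖ ^ 2 * p.1 k := by
  rw [unitaryMap_coe, Matrix.mul_apply, Complex.re_sum]
  refine Finset.sum_congr rfl fun k _ => ?_
  simp only [diagState]
  rw [Matrix.mul_diagonal, Matrix.conjTranspose_apply, Complex.star_def, mul_right_comm,
    Complex.mul_conj, ← Complex.ofReal_mul, Complex.ofReal_re, Complex.normSq_eq_norm_sq]

/-- The entropy of a state is at most the entropy of its diagonal. -/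
theorem matrixEntropy_le_diagPart (ρ : densityMatrices n) :
    matrixEntropy ρ.1 ≤ ∑ i, Real.negMulLog ((diagPart ρ).1 i) := by
  obtain ⟨U, p, rfl⟩ := exists_eq_unitaryMap_diagState ρ
  rw [matrixEntropy_unitaryMap_diagState]
  have hJ : ∀ i, ∑ k, ‖U.1 i k‖ ^ 2 * Real.negMulLog (p.1 k) ≤
      Real.negMulLog ((diagPart (unitaryMap U (diagState p))).1 i) := fun i => by
    have := Real.concaveOn_negMulLog.le_map_sum (t := Finset.univ) (w := fun k => ‖U.1 i k‖ ^ 2)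
      (p := fun k => p.1 k) (fun k _ => by positivity) (sum_normSq_row U i)
      (fun k _ => Set.mem_Ici.2 (p.2.1 k))
    simp only [smul_eq_mul] at this
    refine this.trans_eq ?_
    congr 1
    exact (unitaryMap_diagState_apply_self U p i).symm
  refine le_trans (le_of_eq ?_) (Finset.sum_le_sum fun i _ => hJ i)
  rw [Finset.sum_comm]
  refine Finset.sum_congr rfl fun k _ => ?_
  rw [← Finset.sum_mul, sum_normSq_col, one_mul]

/-- The convex function x log x lies above its tangent at `b`. The case `b = 0`, where the
derivative is -∞, is saved by `h` and by `Real.log 0 = 0`. -/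
theorem mul_log_tangent {a b : ℝ} (ha : 0 ≤ a) (hb : 0 ≤ b) (h : b = 0 → a = 0) :
    a * Real.log a ≥ b * Real.log b + (a - b) * Real.log b + (a - b) := by
  rcases hb.eq_or_lt with rfl | hb
  · simp [h rfl]
  · have h1 := Real.self_sub_one_le_mul_log (x := a / b) (by positivity)
    rcases ha.eq_or_lt with rfl | ha
    · simp; linarith
    · rw [Real.log_div ha.ne' hb.ne'] at h1
      have := mul_le_mul_of_nonneg_left h1 hb.le
      have e1 : b * (a / b - 1) = a - b := by field_simp
      have e2 : b * (a / b * (Real.log a - Real.log b)) = a * Real.log a - a * Real.log b := by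
        field_simp
      rw [e1, e2] at this
      linarith

theorem unitaryMap_diagState_mulVec_single (U : Matrix.unitaryGroup n ℂ) {p : stdSimplex ℝ n}
    {i : n} (hi : p.1 i = 0) :
    (unitaryMap U (diagState p)).1 *ᵥ (U.1 *ᵥ Pi.single i 1) = 0 := by
  have hU : U.1ᴴ * U.1 = 1 := Matrix.mem_unitaryGroup_iff'.1 U.2
  rw [unitaryMap_coe, Matrix.mulVec_mulVec, Matrix.mul_assoc, hU, mul_one, ← Matrix.mulVec_mulVec]
  have : (diagState p).1 *ᵥ (Pi.single i 1 : n → ℂ) = 0 := by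
    simp only [diagState, Matrix.mulVec_single_one]
    ext a
    simp only [Matrix.col_apply, Matrix.diagonal_apply, Pi.zero_apply]
    split_ifs with h
    · rw [h, hi, Complex.ofReal_zero]
    · rfl
  rw [this, Matrix.mulVec_zero]

/-- Klein's inequality. -/
theorem klein_inequality {ρ σ : densityMatrices n}
    (hker : ∀ v : n → ℂ, σ.1 *ᵥ v = 0 → ρ.1 *ᵥ v = 0) :
    -matrixEntropy σ.1 + ((ρ.1 - σ.1) * cfc Real.log σ.1).trace.re ≤ -matrixEntropy ρ.1 := by
  obtain ⟨U, p, rfl⟩ := exists_eq_unitaryMap_diagState σ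
  have hU : U.1ᴴ * U.1 = 1 := Matrix.mem_unitaryGroup_iff'.1 U.2
  rw [trace_mul_cfc_unitaryMap_diagState, matrixEntropy_unitaryMap_diagState,
    ← matrixEntropy_unitaryMap (star U) ρ]
  -- In an eigenbasis of σ only the diagonal `q` of ρ meets log σ. Passing from ρ to `q` can only
  -- raise the entropy, which leaves a sum of scalar tangent inequalities.
  set q := diagPart (unitaryMap (star U) ρ) with hq
  have hconj : U.1ᴴ * (unitaryMap U (diagState p)).1 * U.1 = (diagState p).1 := by
    rw [← star_unitaryMap, ← unitaryMap_mul, Unitary.star_mul_self, unitaryMap_one]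
  have hentry : ∀ i, ((U.1ᴴ * (ρ.1 - (unitaryMap U (diagState p)).1) * U.1) i i).re =
      q.1 i - p.1 i := fun i => by
    rw [mul_sub, sub_mul, hconj, ← star_unitaryMap, Matrix.sub_apply, Complex.sub_re]
    simp [hq, diagPart, diagState]
  simp only [hentry]
  have hzero : ∀ i, p.1 i = 0 → q.1 i = 0 := fun i hi => by
    have h1 := unitaryMap_diagState_mulVec_single U hi
    have h2 := hker _ h1
    have h3 : (U.1ᴴ * ρ.1 * U.1) *ᵥ (Pi.single i 1 : n → ℂ) = 0 := by
      rw [Matrix.mul_assoc, ← Matrix.mulVec_mulVec, ← Matrix.mulVec_mulVec, h2, Matrix.mulVec_zero]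
    have h4 := congrFun h3 i
    simp only [Matrix.mulVec_single_one, Matrix.col_apply, Pi.zero_apply] at h4
    simp only [hq, diagPart, star_unitaryMap, h4, Complex.zero_re]
  have hP := matrixEntropy_le_diagPart (unitaryMap (star U) ρ)
  rw [← hq] at hP
  have hT := Finset.sum_le_sum fun i (_ : i ∈ Finset.univ) =>
    mul_log_tangent (q.2.1 i) (p.2.1 i) (hzero i)
  simp only [Finset.sum_add_distrib, Finset.sum_sub_distrib, q.2.2, p.2.2] at hT
  simp only [Real.negMulLog, Finset.sum_neg_distrib, neg_mul] at hP ⊢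
  linarith

end Quantum

end Regret

/-! ### Slope of the negative entropy when ker σ ⊆ ker ρ. -/

namespace Regret

section Quantum

open scoped ComplexOrder Matrix

variable {n : Type*} [Fintype n]

/-- The state at parameter `u` on the segment from `σ` to `ρ`. -/
noncomputable def mixState (ρ σ : densityMatrices n) (u : ℝ) (h0 : 0 ≤ u) (h1 : u ≤ 1) :
    densityMatrices n :=
  ⟨σ.1 + u • (ρ.1 - σ.1), by
    have := convex_densityMatrices σ.2 ρ.2 (sub_nonneg.2 h1) h0 (by ring)
    convert this using 1
    module⟩

theorem mixState_coe (ρ σ : densityMatrices n) (u : ℝ) (h0 : 0 ≤ u) (h1 : u ≤ 1) :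
    (mixState ρ σ u h0 h1).1 = (1 - u) • σ.1 + u • ρ.1 := by
  simp only [mixState]
  module

theorem mixState_mulVec_eq_zero {ρ σ : densityMatrices n} {u : ℝ} (h0 : 0 ≤ u) (h1 : u < 1)
    {v : n → ℂ} (hv : (mixState ρ σ u h0 h1.le).1 *ᵥ v = 0) : σ.1 *ᵥ v = 0 := by
  rw [← σ.2.1.dotProduct_mulVec_zero_iff]
  have h := congrArg (star v ⬝ᵥ ·) hv
  simp only [mixState_coe, Matrix.add_mulVec, Matrix.smul_mulVec, dotProduct_add, dotProduct_smul,
    dotProduct_zero] at h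
  have hσ := σ.2.1.dotProduct_mulVec_nonneg v
  have hρ := ρ.2.1.dotProduct_mulVec_nonneg v
  have e1 : 0 ≤ (1 - u) • (star v ⬝ᵥ σ.1 *ᵥ v) := smul_nonneg (by linarith) hσ
  have e2 : 0 ≤ u • (star v ⬝ᵥ ρ.1 *ᵥ v) := smul_nonneg h0 hρ
  have := ((add_eq_zero_iff_of_nonneg e1 e2).1 h).1
  exact (smul_eq_zero.1 this).resolve_left (by linarith)

variable [DecidableEq n]

/-- The slope of the negative entropy is at least the derivative of the linear term. -/
theorem le_segmentSlope_neg_matrixEntropy {ρ σ : densityMatrices n}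
    (hker : ∀ v : n → ℂ, σ.1 *ᵥ v = 0 → ρ.1 *ᵥ v = 0) {u : ℝ} (h0 : 0 < u) (h1 : u < 1) :
    ((ρ.1 - σ.1) * cfc Real.log σ.1).trace.re ≤
      segmentSlope (fun X => -matrixEntropy X) ρ.1 σ.1 u := by
  have h := klein_inequality (ρ := mixState ρ σ u h0.le h1.le) (σ := σ) fun v hv => by
    rw [mixState_coe, Matrix.add_mulVec, Matrix.smul_mulVec, Matrix.smul_mulVec, hv, hker v hv]
    simp
  have e : (mixState ρ σ u h0.le h1.le).1 - σ.1 = u • (ρ.1 - σ.1) := add_sub_cancel_left _ _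
  rw [e, Matrix.smul_mul, Matrix.trace_smul, Complex.smul_re, smul_eq_mul] at h
  rw [segmentSlope, le_inv_mul_iff₀ h0]
  change _ ≤ -matrixEntropy (mixState ρ σ u h0.le h1.le).1 - -matrixEntropy σ.1
  linarith

/-- Klein's inequality based at the mixture instead of at σ. A mixture with `u < 1` has kernel
inside ker σ, so nothing is assumed on ρ and σ, and the bound also serves the divergent case. -/
theorem segmentSlope_neg_matrixEntropy_le (ρ σ : densityMatrices n) {u : ℝ} (h0 : 0 < u)
    (h1 : u < 1) : segmentSlope (fun X => -matrixEntropy X) ρ.1 σ.1 u ≤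
      ((ρ.1 - σ.1) * cfc Real.log (mixState ρ σ u h0.le h1.le).1).trace.re := by
  have h := klein_inequality (ρ := σ) (σ := mixState ρ σ u h0.le h1.le)
    fun v hv => mixState_mulVec_eq_zero h0.le h1 hv
  have e : σ.1 - (mixState ρ σ u h0.le h1.le).1 = (-u) • (ρ.1 - σ.1) := by
    rw [mixState]; module
  rw [e, Matrix.smul_mul, Matrix.trace_smul, Complex.smul_re, smul_eq_mul] at h
  rw [segmentSlope, inv_mul_le_iff₀ h0]
  change -matrixEntropy (mixState ρ σ u h0.le h1.le).1 - -matrixEntropy σ.1 ≤ _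
  linarith

theorem spectrum_subset_Icc (ρ : densityMatrices n) : spectrum ℝ ρ.1 ⊆ Set.Icc 0 1 := by
  have hA := ρ.2.1.1
  rw [hA.spectrum_real_eq_range_eigenvalues]
  rintro _ ⟨i, rfl⟩
  refine ⟨ρ.2.1.eigenvalues_nonneg i, ?_⟩
  have h := congrArg Complex.re hA.trace_eq_sum_eigenvalues
  rw [ρ.2.2] at h
  have h' : ∑ i, hA.eigenvalues i = 1 := by simpa using h.symm
  rw [← h']
  exact Finset.single_le_sum (fun j _ => ρ.2.1.eigenvalues_nonneg j) (Finset.mem_univ i)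

open scoped Matrix.Norms.L2Operator in
theorem tendsto_cfc_mixState (ρ σ : densityMatrices n) {g : ℝ → ℝ} (hg : Continuous g) :
    Tendsto (fun u : ℝ => ((ρ.1 - σ.1) * cfc g (σ.1 + u • (ρ.1 - σ.1))).trace.re) (𝓝[>] 0)
      (𝓝 ((ρ.1 - σ.1) * cfc g σ.1).trace.re) := by
  have h1 : Tendsto (fun u : ℝ => σ.1 + u • (ρ.1 - σ.1)) (𝓝[>] 0) (𝓝 σ.1) := by
    have : Continuous fun u : ℝ => σ.1 + u • (ρ.1 - σ.1) := by fun_prop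
    have h := this.tendsto 0
    simp only [zero_smul, add_zero] at h
    exact h.mono_left nhdsWithin_le_nhds
  have hev : ∀ᶠ u : ℝ in 𝓝[>] 0, 0 ≤ u ∧ u ≤ 1 := by
    filter_upwards [Ioc_mem_nhdsGT (zero_lt_one' ℝ)] with u hu
    exact ⟨hu.1.le, hu.2⟩
  have h2 : Tendsto (fun u : ℝ => cfc g (σ.1 + u • (ρ.1 - σ.1))) (𝓝[>] 0) (𝓝 (cfc g σ.1)) := by
    refine Filter.Tendsto.cfc (p := IsSelfAdjoint) isCompact_Icc g h1 ?_ ?_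
      (spectrum_subset_Icc σ) σ.2.1.1 hg.continuousOn
    · filter_upwards [hev] with u hu
      exact spectrum_subset_Icc (mixState ρ σ u hu.1 hu.2)
    · filter_upwards [hev] with u hu
      exact (mixState ρ σ u hu.1 hu.2).2.1.1
  have h3 : Continuous fun X : Matrix n n ℂ => ((ρ.1 - σ.1) * X).trace.re := by fun_prop
  exact (h3.tendsto _).comp h2

/-- The positive eigenvalues of the states on a segment are bounded away from zero if the segment
starts in a state with the smallest kernel. -/
theorem exists_eigenvalue_gap {ρ σ : densityMatrices n}
    (hker : ∀ v : n → ℂ, σ.1 *ᵥ v = 0 → ρ.1 *ᵥ v = 0) :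
    ∃ δ > 0, ∀ (u : ℝ) (h0 : 0 ≤ u) (h1 : u ≤ 1 / 2) (V : Matrix.unitaryGroup n ℂ)
      (q : stdSimplex ℝ n), mixState ρ σ u h0 (by linarith) = unitaryMap V (diagState q) →
      ∀ i, q.1 i ≠ 0 → δ ≤ q.1 i := by
  obtain ⟨U, p, hσ⟩ := exists_eq_unitaryMap_diagState σ
  obtain ⟨δ, hδ0, hδ⟩ : ∃ δ > 0, ∀ j, p.1 j ≠ 0 → δ ≤ p.1 j := by
    have hne : Nonempty n := by
      by_contra h
      rw [not_nonempty_iff] at h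
      simpa using p.2.2
    obtain ⟨j₀, hj₀⟩ := Finite.exists_min fun j => if p.1 j = 0 then 1 else p.1 j
    refine ⟨if p.1 j₀ = 0 then 1 else p.1 j₀, ?_, fun j hj => ?_⟩
    · split_ifs with h
      · exact one_pos
      · exact (p.2.1 j₀).lt_of_ne' h
    · have := hj₀ j
      rwa [if_neg hj] at this
  refine ⟨δ / 2, by positivity, fun u h0 h1 V q hq i hqi => ?_⟩
  have hV : V.1ᴴ * V.1 = 1 := Matrix.mem_unitaryGroup_iff'.1 V.2
  have hVτ : V.1ᴴ * (mixState ρ σ u h0 (by linarith)).1 = (diagState q).1 * V.1ᴴ := by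
    rw [hq, unitaryMap_coe, ← Matrix.mul_assoc, ← Matrix.mul_assoc, hV, one_mul]
  -- The mixture kills ker σ, so its eigenvectors with nonzero eigenvalue are orthogonal to ker σ.
  -- On them the form of σ is at least its least positive eigenvalue δ; with `u ≤ 1 / 2` half of it
  -- survives.
  have hW : ∀ j, p.1 j = 0 → (star V * U).1 i j = 0 := fun j hj => by
    have e1 : σ.1 *ᵥ (U.1 *ᵥ Pi.single j 1) = 0 := by
      rw [hσ]; exact unitaryMap_diagState_mulVec_single U hj
    have e2 : (mixState ρ σ u h0 (by linarith)).1 *ᵥ (U.1 *ᵥ Pi.single j 1) = 0 := by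
      rw [mixState_coe, Matrix.add_mulVec, Matrix.smul_mulVec, Matrix.smul_mulVec, e1, hker _ e1]
      simp
    have e3 : (V.1ᴴ * (mixState ρ σ u h0 (by linarith)).1) *ᵥ (U.1 *ᵥ Pi.single j 1) = 0 := by
      rw [← Matrix.mulVec_mulVec, e2, Matrix.mulVec_zero]
    rw [hVτ, Matrix.mulVec_mulVec, Matrix.mul_assoc, Matrix.mulVec_single_one] at e3
    have e4 := congrFun e3 i
    simp only [diagState, Matrix.col_apply, Matrix.diagonal_mul, Pi.zero_apply] at e4
    exact (mul_eq_zero.1 e4).resolve_left (by exact_mod_cast hqi)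
  have e1 : q.1 i = (1 - u) * ((unitaryMap (star V) σ).1 i i).re +
      u * ((unitaryMap (star V) ρ).1 i i).re := by
    have : (unitaryMap (star V) (mixState ρ σ u h0 (by linarith))).1 i i = (q.1 i : ℂ) := by
      rw [hq, ← unitaryMap_mul, Unitary.star_mul_self, unitaryMap_one]
      simp [diagState]
    have h := congrArg Complex.re this
    rw [star_unitaryMap, mixState_coe, mul_add, add_mul, Matrix.mul_smul, Matrix.mul_smul,
      Matrix.smul_mul, Matrix.smul_mul, ← star_unitaryMap, ← star_unitaryMap, Matrix.add_apply,
      Matrix.smul_apply, Matrix.smul_apply, Complex.add_re, Complex.smul_re, Complex.smul_re,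
      Complex.ofReal_re] at h
    exact h.symm
  have e2 : δ ≤ ((unitaryMap (star V) σ).1 i i).re := by
    rw [hσ, ← unitaryMap_mul, unitaryMap_diagState_apply_self, ← mul_one δ,
      ← sum_normSq_row (star V * U) i, Finset.mul_sum]
    refine Finset.sum_le_sum fun j _ => ?_
    by_cases hj : p.1 j = 0
    · rw [hW j hj]; simp
    · rw [mul_comm]
      exact mul_le_mul_of_nonneg_left (hδ j hj) (by positivity)
  have e3 : 0 ≤ ((unitaryMap (star V) ρ).1 i i).re :=
    (diagPart (unitaryMap (star V) ρ)).2.1 i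
  rw [e1]
  have : 1 / 2 * δ ≤ (1 - u) * ((unitaryMap (star V) σ).1 i i).re :=
    mul_le_mul (by linarith) e2 hδ0.le (by linarith)
  have := mul_nonneg h0 e3
  linarith

theorem tendsto_segmentSlope_of_ker_le {ρ σ : densityMatrices n}
    (hker : ∀ v : n → ℂ, σ.1 *ᵥ v = 0 → ρ.1 *ᵥ v = 0) :
    Tendsto (segmentSlope (fun X => -matrixEntropy X) ρ.1 σ.1) (𝓝[>] 0)
      (𝓝 ((ρ.1 - σ.1) * cfc Real.log σ.1).trace.re) := by
  obtain ⟨δ, hδ, hgap⟩ := exists_eigenvalue_gap hker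
  -- A continuous function equal to `Real.log` at 0, where the latter is 0 by default, and on [δ,
  -- ∞). By the gap it acts as the logarithm on the segment near σ.
  set g : ℝ → ℝ := fun x => Real.log (max x δ) * min 1 (max 0 (x / δ)) with hg
  have hgc : Continuous g := by
    refine Continuous.mul (Continuous.log (by fun_prop) fun x => ?_) (by fun_prop)
    have := le_max_right x δ
    linarith
  have hglog : ∀ x, x = 0 ∨ δ ≤ x → g x = Real.log x := fun x hx => by
    rcases hx with rfl | hx
    · simp [hg]
    · have : 1 ≤ x / δ := by rwa [le_div_iff₀ hδ, one_mul]
      simp only [hg]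
      rw [max_eq_left hx, max_eq_right (by linarith), min_eq_left this, mul_one]
  have hcfc : ∀ (u : ℝ) (h0 : 0 ≤ u) (h1 : u ≤ 1 / 2),
      cfc Real.log (σ.1 + u • (ρ.1 - σ.1)) = cfc g (σ.1 + u • (ρ.1 - σ.1)) := fun u h0 h1 => by
    obtain ⟨V, q, hq⟩ := exists_eq_unitaryMap_diagState (mixState ρ σ u h0 (by linarith))
    change cfc Real.log (mixState ρ σ u h0 (by linarith)).1 = cfc g (mixState ρ σ u h0 (by linarith)).1
    rw [hq, cfc_unitaryMap_diagState, cfc_unitaryMap_diagState]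
    congr 4
    funext i
    rw [hglog _ (or_iff_not_imp_left.2 fun hi => hgap u h0 h1 V q hq i hi)]
  have hlim := tendsto_cfc_mixState ρ σ hgc
  have h0 := hcfc 0 le_rfl (by norm_num)
  simp only [zero_smul, add_zero] at h0
  rw [← h0] at hlim
  have hev : ∀ᶠ u : ℝ in 𝓝[>] 0, 0 < u ∧ u ≤ 1 / 2 := Ioc_mem_nhdsGT (by norm_num)
  refine tendsto_of_tendsto_of_tendsto_of_le_of_le' tendsto_const_nhds hlim ?_ ?_
  · filter_upwards [hev] with u hu
    exact le_segmentSlope_neg_matrixEntropy hker hu.1 (by linarith [hu.2])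
  · filter_upwards [hev] with u hu
    rw [← hcfc u hu.1.le hu.2]
    exact segmentSlope_neg_matrixEntropy_le ρ σ hu.1 (by linarith [hu.2])

end Quantum

end Regret

/-! ### Divergence of the slope when ker σ ⊄ ker ρ. -/

namespace Regret

section Quantum

open scoped ComplexOrder Matrix

variable {n : Type*} [Fintype n] [DecidableEq n]

theorem dotProduct_unitaryMap_mulVec (U : Matrix.unitaryGroup n ℂ) (ρ : densityMatrices n)
    (v : n → ℂ) : star v ⬝ᵥ (unitaryMap U ρ).1 *ᵥ v = star (U.1ᴴ *ᵥ v) ⬝ᵥ ρ.1 *ᵥ (U.1ᴴ *ᵥ v) := by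
  rw [unitaryMap_coe, ← Matrix.mulVec_mulVec, ← Matrix.mulVec_mulVec, Matrix.star_mulVec,
    Matrix.conjTranspose_conjTranspose, Matrix.dotProduct_mulVec]

theorem dotProduct_diagState_mulVec (p : stdSimplex ℝ n) (v : n → ℂ) :
    (star v ⬝ᵥ (diagState p).1 *ᵥ v).re = ∑ i, p.1 i * ‖v i‖ ^ 2 := by
  rw [dotProduct, Complex.re_sum]
  refine Finset.sum_congr rfl fun i _ => ?_
  simp only [diagState, Matrix.mulVec_diagonal, Pi.star_apply]
  rw [mul_left_comm, Complex.star_def, mul_comm (starRingEnd ℂ (v i)), Complex.mul_conj,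
    ← Complex.ofReal_mul, Complex.ofReal_re, Complex.normSq_eq_norm_sq]

/-- A quadratic form is bounded by its diagonal part. -/
theorem dotProduct_mulVec_le_card_mul (ρ : densityMatrices n) (c : n → ℂ) :
    (star c ⬝ᵥ ρ.1 *ᵥ c).re ≤ Fintype.card n * ∑ i, ‖c i‖ ^ 2 * (ρ.1 i i).re := by
  obtain ⟨W, α, rfl⟩ := exists_eq_unitaryMap_diagState ρ
  rw [dotProduct_unitaryMap_mulVec, dotProduct_diagState_mulVec]
  simp only [unitaryMap_diagState_apply_self]
  have hk : ∀ k, ‖(W.1ᴴ *ᵥ c) k‖ ^ 2 ≤ Fintype.card n * ∑ i, ‖W.1 i k‖ ^ 2 * ‖c i‖ ^ 2 := fun k => by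
    have h1 : ‖(W.1ᴴ *ᵥ c) k‖ ≤ ∑ i, ‖W.1 i k‖ * ‖c i‖ := by
      refine (norm_sum_le _ _).trans (Finset.sum_le_sum fun i _ => ?_)
      simp
    have h2 := sq_sum_le_card_mul_sum_sq (s := Finset.univ) (f := fun i => ‖W.1 i k‖ * ‖c i‖)
    simp only [mul_pow, Finset.card_univ] at h2
    exact (pow_le_pow_left₀ (norm_nonneg _) h1 2).trans h2
  calc ∑ k, α.1 k * ‖(W.1ᴴ *ᵥ c) k‖ ^ 2
      ≤ ∑ k, α.1 k * (Fintype.card n * ∑ i, ‖W.1 i k‖ ^ 2 * ‖c i‖ ^ 2) :=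
        Finset.sum_le_sum fun k _ => mul_le_mul_of_nonneg_left (hk k) (α.2.1 k)
    _ = Fintype.card n * ∑ i, ‖c i‖ ^ 2 * ∑ k, ‖W.1 i k‖ ^ 2 * α.1 k := by
        simp only [Finset.mul_sum]
        rw [Finset.sum_comm]
        exact Finset.sum_congr rfl fun i _ => Finset.sum_congr rfl fun k _ => by ring

theorem neg_mul_log_le {s q : ℝ} (hs : 0 ≤ s) (hq : 1 / 2 * s ≤ q) :
    -(s * Real.log q) ≤ 1 + s * Real.log 2 := by
  rcases hs.eq_or_lt with rfl | hs
  · simp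
  · have h1 : Real.log (1 / 2 * s) ≤ Real.log q := Real.log_le_log (by positivity) hq
    rw [one_div, Real.log_mul (by norm_num) hs.ne', Real.log_inv] at h1
    have h2 := Real.self_sub_one_le_mul_log hs.le
    have h3 := mul_le_mul_of_nonneg_left h1 hs.le
    linarith

/-- In an eigenbasis of the mixture, `v` has energy only `u * w`. Some eigenvector carries at least
`w / N ^ 2` of the weight of `v` under ρ; its eigenvalue is then at most `u * N ^ 2`, while its
ρ-weight is bounded below. The σ terms stay bounded because q ≥ s / 2. -/
theorem segmentSlope_le_log {ρ σ : densityMatrices n} {v : n → ℂ} (hσ : σ.1 *ᵥ v = 0)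
    (hρ : ρ.1 *ᵥ v ≠ 0) :
    ∃ κ > 0, ∀ u : ℝ, 0 < u → u ≤ 1 / 2 → u * (Fintype.card n : ℝ) ^ 2 ≤ 1 →
      segmentSlope (fun X => -matrixEntropy X) ρ.1 σ.1 u ≤
        κ * Real.log (u * (Fintype.card n : ℝ) ^ 2) + (Fintype.card n + Real.log 2) := by
  set N : ℝ := (Fintype.card n : ℝ) with hN
  set w : ℝ := (star v ⬝ᵥ ρ.1 *ᵥ v).re with hw
  have hw0 : 0 < w := by
    have h1 := ρ.2.1.dotProduct_mulVec_nonneg v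
    have h2 : star v ⬝ᵥ ρ.1 *ᵥ v ≠ 0 := fun h => hρ ((ρ.2.1.dotProduct_mulVec_zero_iff v).1 h)
    exact (Complex.lt_def.1 (h1.lt_of_ne' h2)).1
  have hne : Nonempty n := by
    by_contra h
    rw [not_nonempty_iff] at h
    exact hρ (Subsingleton.elim _ _)
  have hN0 : 0 < N := by rw [hN]; exact_mod_cast Fintype.card_pos
  set Q : ℝ := ∑ i, ‖v i‖ ^ 2 with hQ
  have hQ0 : 0 < Q := by
    refine (Finset.sum_nonneg fun i _ => by positivity).lt_of_ne' fun h => hρ ?_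
    have : v = 0 := funext fun i => by
      have := (Finset.sum_eq_zero_iff_of_nonneg fun i _ => by positivity).1 h i (Finset.mem_univ i)
      simpa using this
    rw [this, Matrix.mulVec_zero]
  refine ⟨w / (N ^ 2 * Q), by positivity, fun u hu0 hu1 huN => ?_⟩
  refine (segmentSlope_neg_matrixEntropy_le ρ σ hu0 (by linarith)).trans ?_
  obtain ⟨V, q, hq⟩ := exists_eq_unitaryMap_diagState (mixState ρ σ u hu0.le (by linarith))
  rw [hq, trace_mul_cfc_unitaryMap_diagState]
  set r := diagPart (unitaryMap (star V) ρ) with hr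
  set s := diagPart (unitaryMap (star V) σ) with hs
  set c : n → ℂ := V.1ᴴ *ᵥ v with hc
  have hent : ∀ i, ((V.1ᴴ * (ρ.1 - σ.1) * V.1) i i).re = r.1 i - s.1 i := fun i => by
    rw [mul_sub, sub_mul, ← star_unitaryMap, ← star_unitaryMap]; rfl
  have hqi : ∀ i, q.1 i = (1 - u) * s.1 i + u * r.1 i := fun i => by
    have : (unitaryMap (star V) (mixState ρ σ u hu0.le (by linarith))).1 i i = (q.1 i : ℂ) := by
      rw [hq, ← unitaryMap_mul, Unitary.star_mul_self, unitaryMap_one]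
      simp [diagState]
    have h := congrArg Complex.re this
    rw [star_unitaryMap, mixState_coe, mul_add, add_mul, Matrix.mul_smul, Matrix.mul_smul,
      Matrix.smul_mul, Matrix.smul_mul, ← star_unitaryMap, ← star_unitaryMap, Matrix.add_apply,
      Matrix.smul_apply, Matrix.smul_apply, Complex.add_re, Complex.smul_re, Complex.smul_re,
      Complex.ofReal_re] at h
    exact h.symm
  have hle1 : ∀ p : stdSimplex ℝ n, ∀ i, p.1 i ≤ 1 := fun p i => by
    rw [← p.2.2]
    exact Finset.single_le_sum (fun j _ => p.2.1 j) (Finset.mem_univ i)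
  have hcc : ∀ i, ‖c i‖ ^ 2 ≤ Q := fun i => by
    have hnorm : ∑ i, ‖c i‖ ^ 2 = Q := by
      have e : ∀ x : n → ℂ, star x ⬝ᵥ x = ((∑ i, ‖x i‖ ^ 2 : ℝ) : ℂ) := fun x => by
        rw [dotProduct, Complex.ofReal_sum]
        refine Finset.sum_congr rfl fun i _ => ?_
        rw [Pi.star_apply, Complex.star_def, mul_comm, Complex.mul_conj, Complex.normSq_eq_norm_sq]
      have h : star c ⬝ᵥ c = star v ⬝ᵥ v := by
        have hV' : V.1 * V.1ᴴ = 1 := Matrix.mem_unitaryGroup_iff.1 V.2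
        rw [hc, Matrix.star_mulVec, Matrix.conjTranspose_conjTranspose, Matrix.dotProduct_mulVec,
          Matrix.vecMul_vecMul, hV', Matrix.vecMul_one]
      rw [e, e, Complex.ofReal_inj] at h
      exact h
    rw [← hnorm]
    exact Finset.single_le_sum (f := fun i => ‖c i‖ ^ 2) (fun j _ => by positivity)
      (Finset.mem_univ i)
  have hcq : ∑ i, q.1 i * ‖c i‖ ^ 2 = u * w := by
    have h := dotProduct_unitaryMap_mulVec V (diagState q) v
    rw [← hq] at h
    have h' := congrArg Complex.re h
    rw [dotProduct_diagState_mulVec, mixState_coe, Matrix.add_mulVec, Matrix.smul_mulVec,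
      Matrix.smul_mulVec, hσ, smul_zero, zero_add, dotProduct_smul, Complex.smul_re] at h'
    exact h'.symm
  have hcr : w ≤ N * ∑ i, ‖c i‖ ^ 2 * r.1 i := by
    have h := dotProduct_mulVec_le_card_mul (unitaryMap (star V) ρ) c
    have e : star c ⬝ᵥ (unitaryMap (star V) ρ).1 *ᵥ c = star v ⬝ᵥ ρ.1 *ᵥ v := by
      have e2 := dotProduct_unitaryMap_mulVec V (unitaryMap (star V) ρ) v
      rw [← unitaryMap_mul, Unitary.mul_star_self, unitaryMap_one] at e2
      exact e2.symm
    rwa [e] at h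
  obtain ⟨i, -, hi⟩ : ∃ i ∈ Finset.univ, w / N ^ 2 ≤ ‖c i‖ ^ 2 * r.1 i := by
    refine Finset.exists_le_of_sum_le Finset.univ_nonempty ?_
    rw [Finset.sum_const, Finset.card_univ, nsmul_eq_mul, ← hN]
    rw [← div_le_iff₀' hN0] at hcr
    refine le_trans (le_of_eq ?_) hcr
    field_simp
  have hwN : 0 < w / N ^ 2 := by positivity
  have hri0 : 0 < r.1 i := (r.2.1 i).lt_of_ne' fun h => by
    rw [h, mul_zero] at hi; linarith
  have hci : w / N ^ 2 ≤ ‖c i‖ ^ 2 :=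
    hi.trans (mul_le_of_le_one_right (by positivity) (hle1 r i))
  have hqle : q.1 i ≤ u * N ^ 2 := by
    have h1 : q.1 i * ‖c i‖ ^ 2 ≤ u * w := by
      rw [← hcq]
      exact Finset.single_le_sum (f := fun i => q.1 i * ‖c i‖ ^ 2)
        (fun j _ => mul_nonneg (q.2.1 j) (by positivity)) (Finset.mem_univ i)
    have h2 : q.1 i * (w / N ^ 2) ≤ u * w := (mul_le_mul_of_nonneg_left hci (q.2.1 i)).trans h1
    rw [← mul_div_assoc, div_le_iff₀ (by positivity)] at h2
    refine le_of_mul_le_mul_right ?_ hw0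
    linarith
  have hqpos : 0 < q.1 i := by
    rw [hqi]
    have := mul_pos hu0 hri0
    have := mul_nonneg (show 0 ≤ 1 - u by linarith) (s.2.1 i)
    linarith
  have hlogle : Real.log (q.1 i) ≤ Real.log (u * N ^ 2) := Real.log_le_log hqpos hqle
  have hlog0 : Real.log (u * N ^ 2) ≤ 0 := Real.log_nonpos (by positivity) huN
  have hκ : w / (N ^ 2 * Q) ≤ r.1 i := by
    have h1 := hi.trans (mul_le_mul_of_nonneg_right (hcc i) hri0.le)
    rw [div_le_iff₀ (by positivity)] at h1 ⊢
    linarith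
  have hrsum : ∑ j, r.1 j * Real.log (q.1 j) ≤ w / (N ^ 2 * Q) * Real.log (u * N ^ 2) := by
    have h1 : ∑ j, r.1 j * Real.log (q.1 j) ≤ r.1 i * Real.log (q.1 i) := by
      rw [← neg_le_neg_iff, ← Finset.sum_neg_distrib]
      refine Finset.single_le_sum (f := fun j => -(r.1 j * Real.log (q.1 j))) (fun j _ => ?_)
        (Finset.mem_univ i)
      have := mul_nonneg (r.2.1 j) (neg_nonneg.2 (Real.log_nonpos (q.2.1 j) (hle1 q j)))
      linarith
    refine h1.trans ((mul_le_mul_of_nonneg_left hlogle hri0.le).trans ?_)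
    exact mul_le_mul_of_nonpos_right hκ hlog0
  have hssum : ∑ j, -(s.1 j * Real.log (q.1 j)) ≤ N + Real.log 2 := by
    refine (Finset.sum_le_sum fun j _ => neg_mul_log_le (s.2.1 j) (q := q.1 j) ?_).trans_eq ?_
    · rw [hqi]
      have := mul_nonneg hu0.le (r.2.1 j)
      have := mul_nonneg (show 0 ≤ 1 / 2 - u by linarith) (s.2.1 j)
      linarith
    · rw [Finset.sum_add_distrib, ← Finset.sum_mul, s.2.2]
      simp [hN]
  simp only [hent, sub_mul]
  rw [Finset.sum_sub_distrib]
  rw [Finset.sum_neg_distrib] at hssum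
  linarith

theorem tendsto_segmentSlope_of_not_ker_le {ρ σ : densityMatrices n}
    (hker : ¬ ∀ v : n → ℂ, σ.1 *ᵥ v = 0 → ρ.1 *ᵥ v = 0) :
    Tendsto (segmentSlope (fun X => -matrixEntropy X) ρ.1 σ.1) (𝓝[>] 0) atBot := by
  push Not at hker
  obtain ⟨v, hσ, hρ⟩ := hker
  obtain ⟨κ, hκ, h⟩ := segmentSlope_le_log hσ hρ
  set N : ℝ := (Fintype.card n : ℝ) with hN
  have hN0 : 0 < N := by
    rcases isEmpty_or_nonempty n with he | he
    · exact absurd (Subsingleton.elim _ _) hρ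
    · rw [hN]; exact_mod_cast Fintype.card_pos
  have hlim : Tendsto (fun u : ℝ => u * N ^ 2) (𝓝[>] 0) (𝓝[>] 0) := by
    refine tendsto_nhdsWithin_iff.2 ⟨?_, ?_⟩
    · have : Continuous fun u : ℝ => u * N ^ 2 := by fun_prop
      have h := this.tendsto 0
      rw [zero_mul] at h
      exact h.mono_left nhdsWithin_le_nhds
    · filter_upwards [self_mem_nhdsWithin] with u hu
      have : (0 : ℝ) < u := hu
      exact Set.mem_Ioi.2 (by positivity)
  have hbot : Tendsto (fun u : ℝ => κ * Real.log (u * N ^ 2) + (N + Real.log 2)) (𝓝[>] 0) atBot :=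
    tendsto_atBot_add_const_right _ _
      ((Real.tendsto_log_nhdsGT_zero.comp hlim).const_mul_atBot hκ)
  refine tendsto_atBot_mono' _ ?_ hbot
  filter_upwards [Ioc_mem_nhdsGT (show (0 : ℝ) < 1 / 2 by norm_num),
    Ioc_mem_nhdsGT (show (0 : ℝ) < 1 / N ^ 2 by positivity)] with u hu hu'
  refine h u hu.1 hu.2 ?_
  have := hu'.2
  rwa [le_div_iff₀ (by positivity)] at this

end Quantum

end Regret

/-! ### Relative entropy as a Bregman divergence, and the conclusion. -/

namespace Regret

section General

variable {E : Type*} [AddCommGroup E] [Module ℝ E] {S : Set E}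

/-- The regret of a payoff function that is a multiple of `e` up to a linear function. -/
theorem IsPayoff.regret_eq_mul {A : Set (Action S)} {f : E → ℝ} (hf : IsPayoff A f)
    (hS : Convex ℝ S) {c : ℝ} (hc : 0 ≤ c) {e : E → ℝ} {L : E →ₗ[ℝ] ℝ}
    (hfe : ∀ x ∈ S, f x = c * e x + L x) (s₁ s₂ : S) {m : EReal} (hm' : m ≠ ⊤)
    (hm : Tendsto (fun u => ((segmentSlope e s₁ s₂ u : ℝ) : EReal)) (𝓝[>] 0) (𝓝 m)) :
    regret A s₁ s₂ = (c : EReal) * (((e s₁ - e s₂ : ℝ) : EReal) - m) := by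
  have hslope : ∀ᶠ u in 𝓝[>] (0 : ℝ),
      c * segmentSlope e s₁ s₂ u + L ((s₁ : E) - s₂) = segmentSlope f s₁ s₂ u := by
    filter_upwards [Ioc_mem_nhdsGT (zero_lt_one' ℝ)] with u hu
    have hmem : (s₂ : E) + u • ((s₁ : E) - s₂) ∈ S := by
      have := hS s₂.2 s₁.2 (sub_nonneg.2 hu.2) hu.1.le (by ring)
      convert this using 1
      module
    have := hu.1.ne'
    simp only [segmentSlope, hfe _ hmem, hfe _ s₂.2, map_add, map_smul, smul_eq_mul]
    field_simp
    ring
  induction m with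
  | top => exact absurd rfl hm'
  | coe d =>
    have h := ((EReal.tendsto_coe.1 hm).const_mul c).add_const (L ((s₁ : E) - s₂))
    rw [hf.regret_eq hS s₁ s₂ (EReal.tendsto_coe.2 (h.congr' hslope)), hfe _ s₁.2, hfe _ s₂.2]
    rw [← EReal.coe_sub, ← EReal.coe_sub, ← EReal.coe_mul, map_sub]
    congr 1
    ring
  | bot =>
    rw [EReal.sub_bot (EReal.coe_ne_bot _)]
    rcases hc.eq_or_lt with rfl | hc
    -- Here the convention 0·∞ = 0 is used: with `c = 0` the payoff is linear on `S` and its regret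
    -- is 0, although the divergence of `e` is infinite.
    · have h : Tendsto (fun u => 0 * segmentSlope e s₁ s₂ u + L ((s₁ : E) - s₂)) (𝓝[>] 0)
          (𝓝 (L ((s₁ : E) - s₂))) := by simp
      rw [hf.regret_eq hS s₁ s₂ (EReal.tendsto_coe.2 (h.congr' hslope)), hfe _ s₁.2, hfe _ s₂.2,
        ← EReal.coe_sub, map_sub]
      simp
    · have hb : Tendsto (fun u => segmentSlope e s₁ s₂ u) (𝓝[>] 0) atBot :=
        EReal.tendsto_coe_nhds_bot_iff.1 hm
      have h := tendsto_atBot_add_const_right _ (L ((s₁ : E) - s₂)) (hb.const_mul_atBot hc)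
      rw [hf.regret_eq hS s₁ s₂ (EReal.tendsto_coe_nhds_bot_iff.2 (h.congr' hslope)),
        EReal.sub_bot (EReal.coe_ne_bot _), EReal.coe_mul_top_of_pos hc]

end General

section Quantum

open scoped ComplexOrder Matrix

variable {n : Type*} [Fintype n] [DecidableEq n]

/-- Relative entropy is the Bregman divergence of the negative entropy. -/
theorem exists_tendsto_segmentSlope (ρ σ : densityMatrices n) : ∃ m : EReal, m ≠ ⊤ ∧
    Tendsto (fun u => ((segmentSlope (fun X => -matrixEntropy X) ρ.1 σ.1 u : ℝ) : EReal))
      (𝓝[>] 0) (𝓝 m) ∧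
    quantumRelativeEntropy ρ σ = ((-matrixEntropy ρ.1 - -matrixEntropy σ.1 : ℝ) : EReal) - m := by
  by_cases hker : ∀ v : n → ℂ, σ.1 *ᵥ v = 0 → ρ.1 *ᵥ v = 0
  · refine ⟨_, EReal.coe_ne_top _, EReal.tendsto_coe.2 (tendsto_segmentSlope_of_ker_le hker), ?_⟩
    rw [quantumRelativeEntropy, if_pos hker, ← EReal.coe_sub]
    congr 1
    simp only [matrixEntropy, mul_sub, sub_mul, Matrix.trace_sub, Complex.sub_re]
    ring
  · refine ⟨⊥, bot_ne_top,
      EReal.tendsto_coe_nhds_bot_iff.2 (tendsto_segmentSlope_of_not_ker_le hker), ?_⟩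
    rw [quantumRelativeEntropy, if_neg hker, EReal.sub_bot (EReal.coe_ne_bot _)]

theorem quantumRelativeEntropy_diagState (p q : stdSimplex ℝ n) :
    quantumRelativeEntropy (diagState p) (diagState q) = infoDivergence p q := by
  have hmul : ∀ (r : stdSimplex ℝ n) (v : n → ℂ) (i : n),
      ((diagState r).1 *ᵥ v) i = (r.1 i : ℂ) * v i := fun r v i => by
    simp only [diagState, Matrix.mulVec_diagonal]
  have hiff : (∀ v : n → ℂ, (diagState q).1 *ᵥ v = 0 → (diagState p).1 *ᵥ v = 0) ↔
      ∀ i, q.1 i = 0 → p.1 i = 0 := by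
    constructor
    · intro h i hi
      have h1 : (diagState q).1 *ᵥ (Pi.single i 1 : n → ℂ) = 0 := by
        ext j
        rw [hmul]
        by_cases hj : j = i
        · subst hj; simp [hi]
        · simp [hj]
      have h2 := congrFun (h _ h1) i
      rw [hmul] at h2
      simpa using h2
    · intro h v hv
      ext i
      have h1 := congrFun hv i
      rw [hmul, Pi.zero_apply, mul_eq_zero] at h1
      rw [hmul, Pi.zero_apply, mul_eq_zero]
      exact h1.imp_left fun h0 => by
        rw [h i (Complex.ofReal_eq_zero.1 h0), Complex.ofReal_zero]
  unfold quantumRelativeEntropy infoDivergence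
  by_cases hac : ∀ i, q.1 i = 0 → p.1 i = 0
  · rw [if_pos (hiff.2 hac), if_pos (show ∀ i, q i = 0 → p i = 0 from hac)]
    congr 1
    have htr : ∀ r : stdSimplex ℝ n, ((diagState p).1 * cfc Real.log (diagState r).1).trace.re =
        ∑ i, p.1 i * Real.log (r.1 i) := fun r => by
      have := trace_mul_cfc_unitaryMap_diagState Real.log 1 r (diagState p).1
      rw [unitaryMap_one] at this
      rw [this]
      simp [diagState]
    rw [mul_sub, Matrix.trace_sub, Complex.sub_re, htr, htr, ← Finset.sum_sub_distrib]
    refine Finset.sum_congr rfl fun i _ => ?_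
    change p.1 i * _ - p.1 i * _ = p.1 i * Real.log (p.1 i / q.1 i)
    by_cases hp : p.1 i = 0
    · simp [hp]
    · rw [Real.log_div hp fun hq => hp (hac i hq)]
      ring
  · rw [if_neg fun h => hac (hiff.1 h), if_neg (show ¬∀ i, q i = 0 → p i = 0 from hac)]

/-- A unitary is undone by its adjoint at every state, so covariance holds on all segments, and
entropy does not change. The constant term of the affine increment becomes linear through the trace,
which is 1 on states. -/
theorem IsCovariant.isUnitarilyAffine {f : Matrix n n ℂ → ℝ}
    (hf : IsCovariant (quantumTransformations n) f) (c : ℝ) :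
    IsUnitarilyAffine fun ρ : densityMatrices n => f ρ.1 + c * matrixEntropy ρ.1 := by
  intro U
  have hinv : ∀ ρ, unitaryMap (star U) (unitaryMap U ρ) = ρ := fun ρ => by
    rw [← unitaryMap_mul, Unitary.star_mul_self, unitaryMap_one]
  obtain ⟨ℓ, hℓ⟩ := exists_affineMap_of_affineOn (convex_densityMatrices (n := n))
    (fun X => f (U.1 * X * U.1ᴴ) - f X) fun x hx y hy t h0 h1 => by
      have h := hf _ (unitaryMap_mem U) _ (unitaryMap_mem (star U)) ⟨x, hx⟩ ⟨y, hy⟩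
        ⟨_, convex_densityMatrices hx hy (sub_nonneg.2 h1) h0 (by ring)⟩ (hinv _) (hinv _) t h0 h1 rfl
      simp only [unitaryMap_coe] at h
      exact h
  refine ⟨ℓ.linear + ℓ 0 • (Complex.reLm ∘ₗ Matrix.traceLinearMap n ℝ ℂ), fun ρ => ?_⟩
  have h1 := hℓ ρ.1 ρ.2
  have h2 : ℓ ρ.1 = ℓ.linear ρ.1 + ℓ 0 := congrFun (AffineMap.decomp ℓ) ρ.1
  have h3 : (ρ.1.trace).re = 1 := by rw [ρ.2.2, Complex.one_re]
  simp only [LinearMap.add_apply, LinearMap.smul_apply, LinearMap.comp_apply,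
    Matrix.traceLinearMap_apply, Complex.reLm_coe, smul_eq_mul, h3, mul_one,
    matrixEntropy_unitaryMap]
  rw [← h2, ← h1, unitaryMap_coe]
  ring

theorem exists_eq_neg_mul_matrixEntropy (hcard : 3 ≤ Fintype.card n) {f : Matrix n n ℂ → ℝ}
    (hconv : ConvexOn ℝ (densityMatrices n) f)
    (hcov : IsCovariant (quantumTransformations n) f) :
    ∃ c : ℝ, 0 ≤ c ∧ ∃ L : Matrix n n ℂ →ₗ[ℝ] ℝ, ∀ X ∈ densityMatrices n,
      f X = c * -matrixEntropy X + L X := by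
  obtain ⟨c, hc, h⟩ := exists_eq_neg_mul_shannonEntropy hcard (f := fun x => f (diagMap x))
    ((hconv.comp_linearMap diagMap).subset (fun x hx => (diagState ⟨x, hx⟩).2)
      (convex_stdSimplex ℝ n)) hcov.comp_diagMap
  have hd : ∀ p : stdSimplex ℝ n, f (diagState p).1 + c * matrixEntropy (diagState p).1 =
      ∑ i, p.1 i * f (diagMap (Pi.single i 1)) := fun p => by
    have := h p
    rw [shannonEntropy_eq, ← matrixEntropy_diagState] at this
    change f (diagState p).1 = _ at this
    rw [this]
    ring
  obtain ⟨L, hL⟩ := (hcov.isUnitarilyAffine c).exists_linearMap fun p => by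
    simp only [hd]
    simp [vertex, Pi.single_apply]
  refine ⟨c, hc, L, fun X hX => ?_⟩
  rw [← hL ⟨X, hX⟩]
  ring

end Quantum

end Regret

theorem mainTheorem1 :
    (∀ (ι : Type*) [Fintype ι] [DecidableEq ι], 3 ≤ Fintype.card ι →
      ∀ A : Set (Regret.Action (stdSimplex ℝ ι)),
        (∀ p, ∃ r : ℝ, Regret.payoff A p = (r : EReal)) →
        Regret.SufficiencyProperty (Regret.classicalTransformations ι) (Regret.regret A) →
        ∃ c : ℝ, 0 ≤ c ∧
          (∃ ℓ : (ι → ℝ) →ᵃ[ℝ] ℝ, ∀ p,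
            Regret.payoff A p = ((-c * Regret.shannonEntropy p + ℓ p : ℝ) : EReal)) ∧
          ∀ p q, Regret.regret A p q = (c : EReal) * Regret.infoDivergence p q) ∧
    (∀ (n : Type*) [Fintype n] [DecidableEq n], 3 ≤ Fintype.card n →
      ∀ A : Set (Regret.Action (Regret.densityMatrices n)),
        (∀ ρ, ∃ r : ℝ, Regret.payoff A ρ = (r : EReal)) →
        Regret.SufficiencyProperty (Regret.quantumTransformations n) (Regret.regret A) →
        ∃ c : ℝ, 0 ≤ c ∧
          (∃ ℓ : Matrix n n ℂ →ᵃ[ℝ] ℝ, ∀ ρ,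
            Regret.payoff A ρ = ((-c * Regret.vonNeumannEntropy ρ + ℓ ρ : ℝ) : EReal)) ∧
          ∀ ρ σ, Regret.regret A ρ σ = (c : EReal) * Regret.quantumRelativeEntropy ρ σ) := by
  refine ⟨fun ι _ _ hcard A hfin hD => ?_, fun n _ _ hcard A hfin hD => ?_⟩
  · obtain ⟨f, hf⟩ := Regret.exists_isPayoff hfin
    have hS := convex_stdSimplex ℝ ι
    obtain ⟨c, hc, h⟩ := Regret.exists_eq_neg_mul_shannonEntropy hcard (hf.convexOn hS)
      (hf.isCovariant hS Regret.isAffineClass_classicalTransformations hD)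
    let L : (ι → ℝ) →ₗ[ℝ] ℝ := ∑ i, f (Pi.single i 1) • LinearMap.proj i
    have hL : ∀ x, L x = ∑ i, x i * f (Pi.single i 1) := fun x => by
      simp [L, mul_comm]
    refine ⟨c, hc, ⟨L.toAffineMap, fun p => ?_⟩, fun p q => ?_⟩
    · rw [hf p, h p, LinearMap.coe_toAffineMap, hL]
      rfl
    -- The classical slope of entropy is the quantum one along diagonal states, so no separate
    -- derivative computation is needed.
    · obtain ⟨m, hm', hm, he⟩ :=
        Regret.exists_tendsto_segmentSlope (Regret.diagState p) (Regret.diagState q)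
      have hfe : ∀ x ∈ stdSimplex ℝ ι,
          f x = c * (fun x => -Regret.matrixEntropy (Regret.diagMap x)) x + L x := fun x hx => by
        have e : Regret.matrixEntropy (Regret.diagMap x) = Regret.shannonEntropy ⟨x, hx⟩ :=
          Regret.matrixEntropy_diagState ⟨x, hx⟩
        have := h ⟨x, hx⟩
        simp only [e, hL] at this ⊢
        rw [this]
        ring
      rw [hf.regret_eq_mul hS hc hfe p q hm', ← Regret.quantumRelativeEntropy_diagState, he]
      · rfl
      · refine hm.congr fun u => ?_
        simp only [Regret.segmentSlope, map_add, map_sub, map_smul]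
        rfl
  · obtain ⟨f, hf⟩ := Regret.exists_isPayoff hfin
    have hS := Regret.convex_densityMatrices (n := n)
    obtain ⟨c, hc, L, h⟩ := Regret.exists_eq_neg_mul_matrixEntropy hcard (hf.convexOn hS)
      (hf.isCovariant hS Regret.isAffineClass_quantumTransformations hD)
    refine ⟨c, hc, ⟨L.toAffineMap, fun ρ => ?_⟩, fun ρ σ => ?_⟩
    · rw [hf ρ, h ρ.1 ρ.2, mul_neg, neg_mul]
      rfl
    · obtain ⟨m, hm', hm, he⟩ := Regret.exists_tendsto_segmentSlope ρ σ
      rw [hf.regret_eq_mul hS hc h ρ σ hm' hm, he]
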